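/- Let $n\ge 1$, and let $\mathcal X$ be the set of perfect matchings of the complete graph $K_{2n}$ on the vertex set $\{1,\dots,2n\}$. Call a family $\mathcal F\subseteq\mathcal X$ non-Hamiltonian if $m\cup m'$ is not isomorphic to the cycle $C_{2n}$ for any two distinct $m,m'\in\mathcal F$. For an edge $ij$ of $K_{2n}$ let $\mathcal F_{ij}=\{m\in\mathcal X: ij\in m\}$ be the corresponding canonical family. If $\mathcal F\subseteq\mathcal X$ is non-Hamiltonian, then $|\mathcal F|\le (2n-3)!!$ (where $(-1)!!=1$). Moreover, a family $\mathcal F\subseteq\mathcal X$ is non-Hamiltonian with $|\mathcal F|=(2n-3)!!$ if and only if $\mathcal F=\mathcal F_{ij}$ for some edge $ij$ of $K_{2n}$. -/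

import Mathlib

open scoped Nat

/-- The perfect matchings of the complete graph `K_{2n}` on `2n` labelled vertices. -/
def PerfectMatching (n : ℕ) : Type :=
  {m : (⊤ : SimpleGraph (Fin (2 * n))).Subgraph // m.IsPerfectMatching}

namespace PerfectMatching

variable {n : ℕ}

/-- The union `m ∪ m'` of two perfect matchings, as a graph on the `2n` vertices of `K_{2n}`. -/
def union (m m' : PerfectMatching n) : SimpleGraph (Fin (2 * n)) :=
  m.1.spanningCoe ⊔ m'.1.spanningCoe

/-- A family is non-Hamiltonian if no two of its members have a union isomorphic to the cycle
`C_{2n}`. For `2 ≤ n` the restriction to distinct members is immaterial, since `m ∪ m` is then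
never a cycle; for `n = 1` there are no two distinct matchings. -/
def IsNonHamiltonian (F : Finset (PerfectMatching n)) : Prop :=
  ∀ m ∈ F, ∀ m' ∈ F, m ≠ m' →
    ¬ Nonempty (m.union m' ≃g SimpleGraph.cycleGraph (2 * n))

/-- The canonical family `F_{ij}` of all perfect matchings that contain the edge `ij`. -/
def canonicalFamily (i j : Fin (2 * n)) : Set (PerfectMatching n) :=
  {m | s(i, j) ∈ m.1.edgeSet}

/-- A family is canonically intersecting if it is `F_{ij}` for some edge `ij` of `K_{2n}`. -/
def IsCanonicallyIntersecting (F : Finset (PerfectMatching n)) : Prop :=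
  ∃ i j : Fin (2 * n), i ≠ j ∧ (F : Set (PerfectMatching n)) = canonicalFamily i j

end PerfectMatching

/-! This is the ratio bound for the graph on matchings of a `2n`-set `S` in which Hamiltonian pairs
are adjacent; a non-Hamiltonian family is an independent set. For `n ≥ 2` the graph is regular of
degree `(2n-2)‼`. If its least eigenvalue is `-(2n-4)‼`, an independent set has at most `(2n-1)‼ /
(1 + (2n-2)) = (2n-3)‼` members.

A function of total zero splits orthogonally into a weighted edge count (`edgeSum` of a balanced
weighting) and an edge-free part, orthogonal to every canonical indicator
(`exists_edgeSum_add_isEdgeFree`). On edge counts the operator is the scalar `-(2n-4)‼`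
(`hamSum_edgeSum`). On edge-free functions the value `-(2n-4)‼` must be beaten strictly.

For this, an edge `uv` of `σ` is contracted: the Hamiltonian partners of `σ` are the switches of the
Hamiltonian partners of the contracted matching (`hamSum_link`). By induction on `n` the norm of the
operator on edge-free functions is controlled by a quadratic form `switchForm`
(`IsEdgeFree.sum_hamSum_sq_le_switchForm`). That form is bounded by a second induction, which passes
to matchings containing a fixed edge (`le_sum_switchForm_link`, `switchForm_le`). The resulting
estimate is strict for `n ≥ 4`; for `n = 3` the edge-free eigenvalue is `+2`, and for `n = 2`
edge-free functions vanish.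

In the case of equality the indicator of the family is therefore a constant plus an edge count, and
nonnegativity of the indicator on switches forces a canonical family (`exists_canonical_subset`). -/

set_option linter.unusedSectionVars false

namespace MatchingScheme

open Equiv Finset

variable {V : Type*} [Fintype V] [DecidableEq V]

/-- The perfect matchings of the complete graph on `S`, encoded as the involutions of `V` whose
set of moved points is exactly `S`. -/
def matchings (S : Finset V) : Finset (Perm V) :=
  univ.filter fun σ => (∀ x, σ (σ x) = x) ∧ ∀ x, σ x ≠ x ↔ x ∈ S

/-- The conjugate of a permutation by the transposition `(u y)`. -/
def switch (u y : V) (σ : Perm V) : Perm V := swap u y * σ * swap u y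

lemma mem_matchings {S : Finset V} {σ : Perm V} :
    σ ∈ matchings S ↔ (∀ x, σ (σ x) = x) ∧ ∀ x, σ x ≠ x ↔ x ∈ S := by
  simp [matchings]

/-! ### Switching two vertices of a matching; adding and removing an edge. -/

section Basic

variable {S : Finset V} {σ τ : Perm V} {u v x y : V}

lemma apply_apply (h : σ ∈ matchings S) (x : V) : σ (σ x) = x := (mem_matchings.1 h).1 x

lemma apply_ne (h : σ ∈ matchings S) (hx : x ∈ S) : σ x ≠ x := ((mem_matchings.1 h).2 x).2 hx

lemma apply_mem (h : σ ∈ matchings S) (hx : x ∈ S) : σ x ∈ S := by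
  rw [← (mem_matchings.1 h).2, apply_apply h]
  exact (apply_ne h hx).symm

lemma apply_of_notMem (h : σ ∈ matchings S) (hx : x ∉ S) : σ x = x := by
  by_contra h'
  exact hx (((mem_matchings.1 h).2 x).1 h')

lemma apply_eq_iff (h : σ ∈ matchings S) : σ x = y ↔ σ y = x :=
  ⟨fun e => by rw [← e, apply_apply h], fun e => by rw [← e, apply_apply h]⟩

lemma switch_apply (u y : V) (σ : Perm V) (x : V) :
    switch u y σ x = swap u y (σ (swap u y x)) := rfl

lemma switch_switch (u y : V) (σ : Perm V) : switch u y (switch u y σ) = σ := by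
  ext x; simp [switch_apply]

/-- Conjugation renames `u` and `y`, so the edges `u (σ u)` and `y (σ y)` become `u (σ y)` and `y (σ
u)`. This and the next three lemmas record the four changed values. -/
lemma switch_apply_left (hσ : σ ∈ matchings S) (hy : y ∈ S) (huy : y ≠ σ u) :
    switch u y σ u = σ y := by
  have h1 : σ y ≠ u := fun h => huy ((apply_eq_iff hσ).1 h).symm
  rw [switch_apply, swap_apply_left, swap_apply_of_ne_of_ne h1 (apply_ne hσ hy)]

lemma switch_apply_right (hσ : σ ∈ matchings S) (hu : u ∈ S) (huy : y ≠ σ u) :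
    switch u y σ y = σ u := by
  rw [switch_apply, swap_apply_right, swap_apply_of_ne_of_ne (apply_ne hσ hu) huy.symm]

lemma switch_apply_apply_left (hσ : σ ∈ matchings S) (hu : u ∈ S) (huy : y ≠ σ u) :
    switch u y σ (σ u) = y := by
  rw [switch_apply, swap_apply_of_ne_of_ne (apply_ne hσ hu) huy.symm, apply_apply hσ,
    swap_apply_left]

lemma switch_apply_apply_right (hσ : σ ∈ matchings S) (hy : y ∈ S) (huy : y ≠ σ u) :
    switch u y σ (σ y) = u := by
  have h1 : σ y ≠ u := fun h => huy ((apply_eq_iff hσ).1 h).symm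
  rw [switch_apply, swap_apply_of_ne_of_ne h1 (apply_ne hσ hy), apply_apply hσ,
    swap_apply_right]

lemma switch_apply_of_ne (hσ : σ ∈ matchings S) (h1 : x ≠ u) (h2 : x ≠ y) (h3 : x ≠ σ u)
    (h4 : x ≠ σ y) : switch u y σ x = σ x := by
  rw [switch_apply, swap_apply_of_ne_of_ne h1 h2, swap_apply_of_ne_of_ne]
  · exact fun h => h3 ((apply_eq_iff hσ).1 h).symm
  · exact fun h => h4 ((apply_eq_iff hσ).1 h).symm

lemma swap_mem_iff (hu : u ∈ S) (hy : y ∈ S) : swap u y x ∈ S ↔ x ∈ S := by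
  rw [swap_apply_def]
  split_ifs with h1 h2 <;> simp_all

lemma switch_mem (hσ : σ ∈ matchings S) (hu : u ∈ S) (hy : y ∈ S) :
    switch u y σ ∈ matchings S := by
  refine mem_matchings.2 ⟨fun x => by simp [switch_apply, apply_apply hσ], fun x => ?_⟩
  rw [switch_apply, Ne, swap_apply_eq_iff, ← Ne, (mem_matchings.1 hσ).2, swap_mem_iff hu hy]

lemma apply_eq_self_left (hτ : τ ∈ matchings (S \ {u, v})) : τ u = u :=
  apply_of_notMem hτ (by simp)

lemma apply_eq_self_right (hτ : τ ∈ matchings (S \ {u, v})) : τ v = v :=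
  apply_of_notMem hτ (by simp)

/-- As `τ` fixes `u` and `v`, multiplying by their transposition adds the edge `uv`. -/
lemma link_apply_left (hτ : τ ∈ matchings (S \ {u, v})) : (τ * swap u v) u = v := by
  simp [apply_eq_self_right hτ]

lemma link_apply_right (hτ : τ ∈ matchings (S \ {u, v})) : (τ * swap u v) v = u := by
  simp [apply_eq_self_left hτ]

lemma link_apply_of_ne (h1 : x ≠ u) (h2 : x ≠ v) : (τ * swap u v) x = τ x := by
  simp [swap_apply_of_ne_of_ne h1 h2]

lemma link_mem (hu : u ∈ S) (hv : v ∈ S) (huv : u ≠ v) (hτ : τ ∈ matchings (S \ {u, v})) :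
    τ * swap u v ∈ matchings S := by
  have key : ∀ x, x ≠ u → x ≠ v → τ x ≠ u ∧ τ x ≠ v := fun x h1 h2 =>
    ⟨fun h => h1 (by rw [apply_eq_iff hτ, apply_eq_self_left hτ] at h; exact h.symm),
     fun h => h2 (by rw [apply_eq_iff hτ, apply_eq_self_right hτ] at h; exact h.symm)⟩
  refine mem_matchings.2 ⟨fun x => ?_, fun x => ?_⟩
  · by_cases h1 : x = u
    · rw [h1, link_apply_left hτ, link_apply_right hτ]
    by_cases h2 : x = v
    · rw [h2, link_apply_right hτ, link_apply_left hτ]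
    rw [link_apply_of_ne h1 h2, link_apply_of_ne (key x h1 h2).1 (key x h1 h2).2,
      apply_apply hτ]
  · by_cases h1 : x = u
    · rw [h1, link_apply_left hτ]; simp [hu, huv.symm]
    by_cases h2 : x = v
    · rw [h2, link_apply_right hτ]; simp [hv, huv]
    rw [link_apply_of_ne h1 h2, (mem_matchings.1 hτ).2]
    simp [h1, h2]

lemma unlink_mem (hσ : σ ∈ matchings S) (h : σ u = v) :
    σ * swap u v ∈ matchings (S \ {u, v}) := by
  subst h
  have key : ∀ x, x ≠ u → x ≠ σ u → σ x ≠ u ∧ σ x ≠ σ u := fun x h1 h2 =>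
    ⟨fun h => h2 ((apply_eq_iff hσ).1 h).symm, fun h => h1 (σ.injective h)⟩
  have e1 : (σ * swap u (σ u)) u = u := by simp [apply_apply hσ]
  have e2 : (σ * swap u (σ u)) (σ u) = σ u := by simp
  refine mem_matchings.2 ⟨fun x => ?_, fun x => ?_⟩
  · by_cases h1 : x = u
    · rw [h1, e1, e1]
    by_cases h2 : x = σ u
    · rw [h2, e2, e2]
    rw [link_apply_of_ne h1 h2, link_apply_of_ne (key x h1 h2).1 (key x h1 h2).2,
      apply_apply hσ]
  · by_cases h1 : x = u
    · rw [h1, e1]; simp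
    by_cases h2 : x = σ u
    · rw [h2, e2]; simp
    rw [link_apply_of_ne h1 h2, (mem_matchings.1 hσ).2]
    simp [h1, h2]

end Basic

/-! ### Reindexing sums over matchings by links and switches. -/

section Sums

variable {S : Finset V} {u v : V} {R : Type*} [AddCommMonoid R]

lemma sum_filter_apply_eq (hu : u ∈ S) (hv : v ∈ S) (huv : u ≠ v) (F : Perm V → R) :
    ∑ σ ∈ matchings S with σ u = v, F σ = ∑ τ ∈ matchings (S \ {u, v}), F (τ * swap u v) := by
  refine sum_nbij' (fun σ => σ * swap u v) (fun τ => τ * swap u v) ?_ ?_ ?_ ?_ ?_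
  · intro σ hσ
    rw [mem_filter] at hσ
    exact unlink_mem hσ.1 hσ.2
  · intro τ hτ
    exact mem_filter.2 ⟨link_mem hu hv huv hτ, link_apply_left hτ⟩
  all_goals intros; simp

/-- The matchings in which `u` and `v` are not joined arise in a unique way from a matching that
contains `uv` by switching at `u`. -/
lemma sum_filter_apply_ne (hu : u ∈ S) (hv : v ∈ S) (huv : u ≠ v) (F : Perm V → R) :
    ∑ σ ∈ matchings S with σ u ≠ v, F σ =
      ∑ τ ∈ matchings (S \ {u, v}), ∑ y ∈ S \ {u, v}, F (switch u y (τ * swap u v)) := by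
  rw [← sum_product']
  refine sum_nbij' (fun σ => (switch u (σ v) σ * swap u v, σ v))
    (fun p => switch u p.2 (p.1 * swap u v)) ?_ ?_ ?_ ?_ ?_
  · intro σ hσ
    obtain ⟨hσ, h⟩ := mem_filter.1 hσ
    refine mem_product.2 ⟨unlink_mem (switch_mem hσ hu (apply_mem hσ hv)) ?_, ?_⟩
    · rw [switch_apply_left hσ (apply_mem hσ hv), apply_apply hσ]
      exact fun h => huv (σ.injective h).symm
    · have : σ v ≠ u := fun h' => h ((apply_eq_iff hσ).1 h')
      simp [apply_mem hσ hv, apply_ne hσ hv, this]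
  · intro p hp
    obtain ⟨hτ, hy⟩ := mem_product.1 hp
    have hl := link_mem hu hv huv hτ
    simp only [mem_sdiff, mem_insert, mem_singleton, not_or] at hy
    obtain ⟨hyS, hyu, hyv⟩ := hy
    refine mem_filter.2 ⟨switch_mem hl hu hyS, ?_⟩
    have h1 := link_apply_left hτ
    rw [switch_apply_left hl hyS (by rwa [h1])]
    exact fun h => hyu ((p.1 * swap u v).injective (h.trans h1.symm))
  · intro σ _
    simp [switch_switch, mul_assoc]
  · intro p hp
    obtain ⟨hτ, hy⟩ := mem_product.1 hp
    have hl := link_mem hu hv huv hτ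
    simp only [mem_sdiff, mem_insert, mem_singleton, not_or] at hy
    obtain ⟨hyS, hyu, hyv⟩ := hy
    have h1 := link_apply_left hτ
    have h2 : switch u p.2 (p.1 * swap u v) v = p.2 := by
      have h3 := switch_apply_apply_left hl hu (y := p.2) (by rwa [h1])
      rwa [h1] at h3
    ext1
    · simp only [h2, switch_switch]
      simp [mul_assoc]
    · exact h2
  · intro σ _
    simp [switch_switch, mul_assoc]

lemma sum_eq_sum_fiber (hu : u ∈ S) (F : Perm V → R) :
    ∑ σ ∈ matchings S, F σ = ∑ v ∈ S.erase u, ∑ σ ∈ matchings S with σ u = v, F σ :=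
  (sum_fiberwise_of_maps_to
    (fun _ hσ => mem_erase.2 ⟨apply_ne hσ hu, apply_mem hσ hu⟩) F).symm

lemma sum_eq_sum_link (hu : u ∈ S) (F : Perm V → R) :
    ∑ σ ∈ matchings S, F σ =
      ∑ v ∈ S.erase u, ∑ τ ∈ matchings (S \ {u, v}), F (τ * swap u v) := by
  rw [sum_eq_sum_fiber hu]
  refine sum_congr rfl fun v hv => ?_
  rw [sum_filter_apply_eq hu (mem_of_mem_erase hv) (ne_of_mem_erase hv).symm]

/-- For fixed `y` switching is an involution. The new partner of `u` is `σ y ≠ y`, so the admissible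
pairs `(σ, y)` are permuted. This makes `switchSum` self-adjoint. -/
lemma sum_switch (hu : u ∈ S) (G : Perm V → Perm V → V → R) :
    ∑ σ ∈ matchings S, ∑ y ∈ S \ {u, σ u}, G σ (switch u y σ) y =
      ∑ σ ∈ matchings S, ∑ y ∈ S \ {u, σ u}, G (switch u y σ) σ y := by
  rw [sum_sigma', sum_sigma']
  have key : ∀ p ∈ (matchings S).sigma fun σ => S \ {u, σ u},
      (⟨switch u p.2 p.1, p.2⟩ : Σ _ : Perm V, V) ∈
        (matchings S).sigma fun σ => S \ {u, σ u} := by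
    rintro ⟨σ, y⟩ hp
    simp only [mem_sigma, mem_sdiff, mem_insert, mem_singleton, not_or] at hp ⊢
    obtain ⟨hσ, hy, hyu, hyv⟩ := hp
    refine ⟨switch_mem hσ hu hy, hy, hyu, ?_⟩
    rw [switch_apply_left hσ hy hyv]
    exact (apply_ne hσ hy).symm
  refine sum_nbij' (fun p => ⟨switch u p.2 p.1, p.2⟩) (fun p => ⟨switch u p.2 p.1, p.2⟩)
    key key ?_ ?_ ?_
  all_goals simp [switch_switch]

end Sums

/-! ### Counting matchings. -/

section Card

variable {S : Finset V} {u v : V}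

lemma card_sdiff_pair (hu : u ∈ S) (hv : v ∈ S) (huv : u ≠ v) :
    (S \ {u, v}).card = S.card - 2 := by
  rw [card_sdiff_of_subset (by simp [insert_subset_iff, hu, hv]), card_pair huv]

lemma matchings_empty : matchings (∅ : Finset V) = {1} := by
  ext σ
  simp only [mem_matchings, mem_singleton, notMem_empty, iff_false, not_not]
  exact ⟨fun h => Equiv.ext h.2, fun h => by simp [h]⟩

lemma card_matchings (n : ℕ) : ∀ S : Finset V, S.card = 2 * n →
    (matchings S).card = (2 * n - 1)‼ := by
  induction n with
  -- Truncated subtraction turns `(-1)‼` into `0‼ = 1`.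
  | zero => intro S hS; simp [card_eq_zero.1 hS, matchings_empty]
  | succ n ih =>
    intro S hS
    obtain ⟨u, hu⟩ : S.Nonempty := card_pos.1 (by omega)
    rw [card_eq_sum_ones, sum_eq_sum_link hu]
    have : ∀ v ∈ S.erase u, ∑ τ ∈ matchings (S \ {u, v}), 1 = (2 * n - 1)‼ := by
      intro v hv
      rw [← card_eq_sum_ones]
      refine ih _ ?_
      rw [card_sdiff_pair hu (mem_of_mem_erase hv) (ne_of_mem_erase hv).symm]
      omega
    rw [sum_congr rfl this, sum_const, card_erase_of_mem hu, hS, smul_eq_mul]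
    rcases n with - | n
    · rfl
    · rw [show 2 * (n + 1 + 1) - 1 = 2 * n + 1 + 2 by omega,
        show 2 * (n + 1) - 1 = 2 * n + 1 by omega, Nat.doubleFactorial_add_two]

lemma matchings_eq_singleton (hS : S.card = 2) {σ : Perm V} (hσ : σ ∈ matchings S) :
    matchings S = {σ} := by
  obtain ⟨τ, hτ⟩ := card_eq_one.1 (card_matchings 1 S hS)
  rw [hτ] at hσ ⊢
  rw [mem_singleton.1 hσ]

end Card

/-! ### The Hamiltonian operator and the contraction of an edge. -/

/-- The union of the matchings `σ` and `τ` of `S` is connected, that is, a Hamiltonian cycle. -/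
def Connects (S : Finset V) (σ τ : Perm V) : Prop :=
  ∀ T ⊆ S, T.Nonempty → (∀ x ∈ T, σ x ∈ T ∧ τ x ∈ T) → T = S

open Classical in
/-- The adjacency operator of the graph of Hamiltonian pairs of matchings of `S`. -/
noncomputable def hamSum (S : Finset V) (f : Perm V → ℝ) (σ : Perm V) : ℝ :=
  ∑ τ ∈ matchings S with Connects S σ τ, f τ

lemma Connects.symm {S : Finset V} {σ τ : Perm V} (h : Connects S σ τ) : Connects S τ σ :=
  fun T hT hne hc => h T hT hne fun x hx => (hc x hx).symm

lemma connects_comm {S : Finset V} {σ τ : Perm V} : Connects S σ τ ↔ Connects S τ σ :=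
  ⟨Connects.symm, Connects.symm⟩

/-- A common edge would be a closed set of two vertices. -/
lemma Connects.apply_ne {S : Finset V} {σ τ : Perm V} {u : V} (h : Connects S σ τ)
    (hS : 2 < S.card) (hσ : σ ∈ matchings S) (hτ : τ ∈ matchings S) (hu : u ∈ S) :
    τ u ≠ σ u := by
  intro e
  have hT := h {u, σ u} (by simp [insert_subset_iff, hu, apply_mem hσ hu]) (by simp) (by
    intro x hx
    simp only [mem_insert, mem_singleton] at hx ⊢
    rcases hx with rfl | rfl
    · simp [e]
    · rw [apply_apply hσ, ← e, apply_apply hτ]; simp)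
  rw [← hT] at hS
  exact absurd hS (by simpa using card_le_two)

section Link

variable {S : Finset V} {u v : V}

/-- In the larger union the edge `y (τ y)` of `τ` is replaced by the path `y, v, u, τ y`, whose
middle edge belongs to the first matching. Subdividing an edge does not affect connectedness. -/
lemma connects_link_iff (hu : u ∈ S) (hv : v ∈ S) (huv : u ≠ v) {σ τ : Perm V} {y : V}
    (hσ : σ ∈ matchings (S \ {u, v})) (hτ : τ ∈ matchings (S \ {u, v})) (hy : y ∈ S \ {u, v}) :
    Connects S (σ * swap u v) (switch u y (τ * swap u v)) ↔ Connects (S \ {u, v}) σ τ := by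
  have hl := link_mem hu hv huv hτ
  have hy' := hy
  simp only [mem_sdiff, mem_insert, mem_singleton, not_or] at hy'
  obtain ⟨hyS, hyu, hyv⟩ := hy'
  have ev := link_apply_left hτ
  have ey : (τ * swap u v) y = τ y := link_apply_of_ne hyu hyv
  have hne : y ≠ (τ * swap u v) u := by rwa [ev]
  have s1 : switch u y (τ * swap u v) u = τ y := by rw [switch_apply_left hl hyS hne, ey]
  have s2 : switch u y (τ * swap u v) y = v := by rw [switch_apply_right hl hu hne, ev]
  have s3 : switch u y (τ * swap u v) v = y := by
    have := switch_apply_apply_left hl hu hne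
    rwa [ev] at this
  have s4 : switch u y (τ * swap u v) (τ y) = u := by
    have := switch_apply_apply_right hl hyS hne
    rwa [ey] at this
  have s5 : ∀ x, x ≠ u → x ≠ v → x ≠ y → x ≠ τ y → switch u y (τ * swap u v) x = τ x := by
    intro x h1 h2 h3 h4
    rw [switch_apply_of_ne hl h1 h3 (by rwa [ev]) (by rwa [ey]), link_apply_of_ne h1 h2]
  have hτy := apply_mem hτ hy
  constructor
  · intro h T hT hTne hc
    have huT : u ∉ T := fun h' => by simpa using hT h'
    have hvT : v ∉ T := fun h' => by simpa using hT h'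
    by_cases hyT : y ∈ T
    · have := h (insert u (insert v T)) (by
        simp only [insert_subset_iff, hu, hv, true_and]
        exact hT.trans sdiff_subset) (by simp) (by
        intro x hx
        by_cases h1 : x = u
        · rw [h1, link_apply_left hσ, s1]; simp [(hc y hyT).2]
        by_cases h2 : x = v
        · rw [h2, link_apply_right hσ, s3]; simp [hyT]
        have hx : x ∈ T := by simpa [h1, h2] using hx
        refine ⟨by rw [link_apply_of_ne h1 h2]; simp [(hc x hx).1], ?_⟩
        by_cases h3 : x = y
        · rw [h3, s2]; simp
        by_cases h4 : x = τ y
        · rw [h4, s4]; simp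
        rw [s5 x h1 h2 h3 h4]; simp [(hc x hx).2])
      rw [← this]
      ext x
      simp only [mem_sdiff, mem_insert, mem_singleton]
      constructor
      · intro hx
        exact ⟨Or.inr (Or.inr hx), by rintro (rfl | rfl) <;> contradiction⟩
      · tauto
    · have hzT : τ y ∉ T := fun h' => hyT (by simpa [apply_apply hτ] using (hc _ h').2)
      have := h T (hT.trans sdiff_subset) hTne (by
        intro x hx
        have h1 : x ≠ u := by rintro rfl; contradiction
        have h2 : x ≠ v := by rintro rfl; contradiction
        have h3 : x ≠ y := by rintro rfl; contradiction
        have h4 : x ≠ τ y := by rintro rfl; contradiction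
        rw [link_apply_of_ne h1 h2, s5 x h1 h2 h3 h4]
        exact hc x hx)
      exact absurd (this ▸ hu) huT
  · intro h T hT hTne hc
    have cu : u ∈ T → v ∈ T := fun h' => by simpa [link_apply_left hσ] using (hc u h').1
    have cv : v ∈ T → u ∈ T := fun h' => by
      have := (hc v h').1
      rwa [link_apply_right hσ] at this
    have cy : v ∈ T → y ∈ T := fun h' => by simpa [s3] using (hc v h').2
    have cy' : y ∈ T → v ∈ T := fun h' => by simpa [s2] using (hc y h').2
    have cz : u ∈ T → τ y ∈ T := fun h' => by simpa [s1] using (hc u h').2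
    have cz' : τ y ∈ T → u ∈ T := fun h' => by simpa [s4] using (hc _ h').2
    have hmem : ∀ {x}, x ∈ S \ {u, v} → x ∈ T → x ∈ T \ {u, v} := fun hx hxT =>
      mem_sdiff.2 ⟨hxT, (mem_sdiff.1 hx).2⟩
    have hT' := h (T \ {u, v}) (sdiff_subset_sdiff hT le_rfl) (by
      obtain ⟨x, hx⟩ := hTne
      by_cases h1 : x = u
      · exact ⟨y, hmem hy (cy (cu (h1 ▸ hx)))⟩
      by_cases h2 : x = v
      · exact ⟨y, hmem hy (cy (h2 ▸ hx))⟩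
      exact ⟨x, by simp [hx, h1, h2]⟩) (by
      intro x hx
      have hx' : x ∈ T ∧ x ≠ u ∧ x ≠ v := by simpa using hx
      obtain ⟨hxT, h1, h2⟩ := hx'
      have hxS : x ∈ S \ {u, v} := by simp [hT hxT, h1, h2]
      refine ⟨hmem (apply_mem hσ hxS) ?_, hmem (apply_mem hτ hxS) ?_⟩
      · have := (hc x hxT).1
        rwa [link_apply_of_ne h1 h2] at this
      · by_cases h3 : x = y
        · rw [h3]; exact cz (cv (cy' (h3 ▸ hxT)))
        by_cases h4 : x = τ y
        · rw [h4, apply_apply hτ]; exact cy (cu (cz' (h4 ▸ hxT)))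
        rw [← s5 x h1 h2 h3 h4]; exact (hc x hxT).2)
    have hyT : y ∈ T := (mem_sdiff.1 (hT' ▸ hy)).1
    refine hT.antisymm fun x hx => ?_
    by_cases h1 : x = u
    · rw [h1]; exact cv (cy' hyT)
    by_cases h2 : x = v
    · rw [h2]; exact cy' hyT
    have : x ∈ T \ {u, v} := by rw [hT']; simp [hx, h1, h2]
    exact (mem_sdiff.1 this).1

/-- Contracting an edge `uv` of `σ` reduces the Hamiltonian pairs on `S` to those on
`S \ {u, v}`. -/
lemma hamSum_link (hS : 2 < S.card) {σ : Perm V} (hσ : σ ∈ matchings S) (hu : u ∈ S)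
    (huv : σ u = v) (f : Perm V → ℝ) :
    hamSum S f σ = hamSum (S \ {u, v})
      (fun τ => ∑ y ∈ S \ {u, v}, f (switch u y (τ * swap u v))) (σ * swap u v) := by
  classical
  have hv : v ∈ S := huv ▸ apply_mem hσ hu
  have hne : u ≠ v := fun h => apply_ne hσ hu (huv.trans h.symm)
  have hσ' := unlink_mem hσ huv
  have e : σ * swap u v * swap u v = σ := by simp [mul_assoc]
  have h1 : hamSum S f σ = ∑ τ ∈ matchings S with τ u ≠ v,
      if Connects S σ τ then f τ else 0 := by
    rw [hamSum, ← sum_filter, filter_filter]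
    refine sum_congr ?_ fun _ _ => rfl
    ext τ
    simp only [mem_filter]
    exact ⟨fun h => ⟨h.1, huv ▸ h.2.apply_ne hS hσ h.1 hu, h.2⟩, fun h => ⟨h.1, h.2.2⟩⟩
  rw [h1, sum_filter_apply_ne hu hv hne, hamSum, sum_filter]
  refine sum_congr rfl fun τ hτ => ?_
  have h2 : ∀ y ∈ S \ {u, v}, (if Connects S σ (switch u y (τ * swap u v)) then
      f (switch u y (τ * swap u v)) else 0) =
      if Connects (S \ {u, v}) (σ * swap u v) τ then f (switch u y (τ * swap u v)) else 0 := by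
    intro y hy
    have := connects_link_iff hu hv hne hσ' hτ hy
    rw [e] at this
    simp only [this]
  rw [sum_congr rfl h2]
  split_ifs <;> simp

end Link

lemma hamSum_symm (S : Finset V) (f g : Perm V → ℝ) :
    ∑ σ ∈ matchings S, f σ * hamSum S g σ = ∑ σ ∈ matchings S, hamSum S f σ * g σ := by
  classical
  simp only [hamSum, sum_filter, mul_sum, sum_mul]
  rw [sum_comm]
  refine sum_congr rfl fun τ _ => sum_congr rfl fun σ _ => ?_
  simp only [connects_comm (σ := σ)]
  split_ifs <;> simp

lemma hamSum_add (S : Finset V) (f g : Perm V → ℝ) (σ : Perm V) :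
    hamSum S (fun τ => f τ + g τ) σ = hamSum S f σ + hamSum S g σ := sum_add_distrib

lemma hamSum_congr {S : Finset V} {f g : Perm V → ℝ} (h : ∀ τ ∈ matchings S, f τ = g τ)
    (σ : Perm V) : hamSum S f σ = hamSum S g σ := by
  classical
  exact sum_congr rfl fun τ hτ => h τ (mem_filter.1 hτ).1

/-- On two vertices the only matching counts as connected with itself, which lets contraction reach
this base case. -/
lemma hamSum_of_card_eq_two {S : Finset V} (hS : S.card = 2) {σ : Perm V}
    (hσ : σ ∈ matchings S) (f : Perm V → ℝ) : hamSum S f σ = f σ := by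
  classical
  have h2 : Connects S σ σ := by
    intro T hT ⟨x, hx⟩ hc
    refine eq_of_subset_of_card_le hT ?_
    rw [hS, ← card_pair (apply_ne hσ (hT hx)).symm]
    exact card_le_card (by simp [insert_subset_iff, hx, (hc x hx).1])
  rw [hamSum, matchings_eq_singleton hS hσ, filter_singleton, if_pos h2, sum_singleton]

/-- The degree of the graph. Contraction keeps a constant constant and multiplies it by the number
of available switches, `|S| - 2`. -/
lemma hamSum_const (k : ℕ) : ∀ S : Finset V, S.card = 2 * (k + 1) → ∀ (c : ℝ),
    ∀ σ ∈ matchings S, hamSum S (fun _ => c) σ = (2 * k)‼ * c := by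
  induction k with
  | zero => intro S hS c σ hσ; simp [hamSum_of_card_eq_two (by omega) hσ]
  | succ k ih =>
    intro S hS c σ hσ
    obtain ⟨u, hu⟩ : S.Nonempty := card_pos.1 (by omega)
    have hc := card_sdiff_pair hu (apply_mem hσ hu) (apply_ne hσ hu).symm
    rw [hamSum_link (by omega) hσ hu rfl]
    simp only [sum_const]
    rw [ih _ (by omega) _ _ (unlink_mem hσ rfl), hc, hS,
      show 2 * (k + 1) = 2 * k + 2 by ring, Nat.doubleFactorial_add_two]
    rw [nsmul_eq_mul, show 2 * (k + 1 + 1) - 2 = 2 * k + 2 by omega]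
    push_cast
    ring

/-! ### Balanced edge weightings under switching. -/

/-- A symmetric edge weighting of the complete graph on `S` whose weights sum to zero at every
vertex. -/
structure IsBalanced (S : Finset V) (w : V → V → ℝ) : Prop where
  symm : ∀ i j, w i j = w j i
  diag : ∀ i, w i i = 0
  row : ∀ i ∈ S, ∑ j ∈ S, w i j = 0

/-- Twice the total weight of the edges of a matching. -/
def edgeSum (S : Finset V) (w : V → V → ℝ) (σ : Perm V) : ℝ := ∑ i ∈ S, w i (σ i)

/-- The sum of `f` over all matchings obtained from `σ` by switching the edge at `u`. -/
def switchSum (S : Finset V) (f : Perm V → ℝ) (σ : Perm V) (u : V) : ℝ :=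
  ∑ y ∈ S \ {u, σ u}, f (switch u y σ)

/-- The functions orthogonal to the indicators of all canonical families. -/
def IsEdgeFree (S : Finset V) (g : Perm V → ℝ) : Prop :=
  ∀ i ∈ S, ∀ j ∈ S.erase i, ∑ σ ∈ matchings S with σ i = j, g σ = 0

section

variable {S : Finset V} {u v : V} {σ : Perm V} {w : V → V → ℝ}

lemma sum_sdiff_pair (hu : u ∈ S) (hv : v ∈ S) (huv : u ≠ v) (g : V → ℝ) :
    ∑ y ∈ S \ {u, v}, g y = ∑ y ∈ S, g y - g u - g v := by
  rw [← sum_sdiff (show {u, v} ⊆ S by simp [insert_subset_iff, hu, hv]), sum_pair huv]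
  ring

lemma sum_comp_apply (hσ : σ ∈ matchings S) (g : V → ℝ) : ∑ i ∈ S, g (σ i) = ∑ i ∈ S, g i := by
  refine sum_nbij' σ σ (fun i hi => apply_mem hσ hi) (fun i hi => apply_mem hσ hi) ?_ ?_ ?_
  all_goals intros; simp [apply_apply hσ]

lemma edgeSum_switch (hw : IsBalanced S w) (hσ : σ ∈ matchings S) (hv : v ∈ S) {y : V}
    (hy : y ∈ S \ {v, σ v}) :
    edgeSum S w (switch v y σ) =
      edgeSum S w σ - 2 * w v (σ v) - 2 * w y (σ y) + 2 * w (σ v) y + 2 * w v (σ y) := by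
  simp only [mem_sdiff, mem_insert, mem_singleton, not_or] at hy
  obtain ⟨hyS, hyv, hy'⟩ := hy
  have d1 : v ≠ σ v := (apply_ne hσ hv).symm
  have d2 : v ≠ σ y := fun h => hy' ((apply_eq_iff hσ).1 h.symm).symm
  have d3 : σ v ≠ σ y := fun h => hyv (σ.injective h).symm
  have d4 : y ≠ σ y := (apply_ne hσ hyS).symm
  have key : ∑ i ∈ S, (w i (switch v y σ i) - w i (σ i)) =
      ∑ i ∈ {v, σ v, y, σ y}, (w i (switch v y σ i) - w i (σ i)) := by
    symm
    refine sum_subset (by simp [insert_subset_iff, hv, hyS, apply_mem hσ]) fun x _ hx => ?_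
    simp only [mem_insert, mem_singleton, not_or] at hx
    rw [switch_apply_of_ne hσ hx.1 hx.2.2.1 hx.2.1 hx.2.2.2, sub_self]
  rw [sum_sub_distrib, sum_insert (by simp [d1, d2, Ne.symm hyv]),
    sum_insert (by simp [Ne.symm hy', d3]), sum_insert (by simp [d4]), sum_singleton,
    switch_apply_left hσ hyS hy', switch_apply_right hσ hv hy',
    switch_apply_apply_left hσ hv hy', switch_apply_apply_right hσ hyS hy', apply_apply hσ,
    apply_apply hσ] at key
  have e1 := hw.symm (σ v) v
  have e2 := hw.symm (σ y) y
  have e3 := hw.symm (σ v) y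
  have e4 := hw.symm (σ y) v
  unfold edgeSum
  linarith

/-- In the sum over `y` of `edgeSum_switch` the weights of the new edges run through rows of `w`;
these sum to zero, so only terms at the edge of `v` and multiples of `edgeSum` survive. -/
lemma switchSum_edgeSum (hw : IsBalanced S w) {n : ℕ} (hS : S.card = 2 * n)
    (hσ : σ ∈ matchings S) (hv : v ∈ S) :
    switchSum S (edgeSum S w) σ v = (2 * n - 4) * edgeSum S w σ - (4 * n - 4) * w v (σ v) := by
  have hv' := apply_mem hσ hv
  have hne := (apply_ne hσ hv).symm
  rw [switchSum, sum_congr rfl fun y hy => edgeSum_switch hw hσ hv hy,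
    sum_sdiff_pair hv hv' hne]
  simp only [sum_add_distrib, sum_sub_distrib, ← mul_sum, sum_const, hS, hw.row _ hv',
    sum_comp_apply hσ (fun j => w v j), hw.row v hv, apply_apply hσ, hw.diag, nsmul_eq_mul,
    hw.symm (σ v) v]
  rw [show ∑ i ∈ S, w i (σ i) = edgeSum S w σ from rfl]
  push_cast
  ring

lemma sum_switchSum_eq (hw : IsBalanced S w) {n : ℕ} (hS : S.card = 2 * n)
    (hσ : σ ∈ matchings S) :
    ∑ v ∈ S, switchSum S (edgeSum S w) σ v = (4 * n ^ 2 - 12 * n + 4) * edgeSum S w σ := by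
  rw [sum_congr rfl fun v hv => switchSum_edgeSum hw hS hσ hv, sum_sub_distrib, ← mul_sum,
    ← mul_sum, show ∑ i ∈ S, w i (σ i) = edgeSum S w σ from rfl, sum_const, hS, nsmul_eq_mul]
  push_cast
  ring

lemma sum_mul_switchSum (hv : v ∈ S) (f g : Perm V → ℝ) :
    ∑ σ ∈ matchings S, f σ * switchSum S g σ v =
      ∑ σ ∈ matchings S, switchSum S f σ v * g σ := by
  simp only [switchSum, mul_sum, sum_mul]
  exact sum_switch hv fun σ τ _ => f σ * g τ

/-- Switching with `y` gives `v` the partner `σ y`, and the row of `v` sums to zero. Hence `σ ↦ w v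
(σ v)` is an eigenfunction of switching at `v`, with eigenvalue `-1`. -/
lemma sum_weight_mul_switchSum (hw : IsBalanced S w) (hv : v ∈ S) (g : Perm V → ℝ) :
    ∑ σ ∈ matchings S, w v (σ v) * switchSum S g σ v =
      -∑ σ ∈ matchings S, w v (σ v) * g σ := by
  simp only [switchSum, mul_sum]
  rw [sum_switch hv fun σ τ _ => w v (σ v) * g τ, ← sum_neg_distrib]
  refine sum_congr rfl fun σ hσ => ?_
  have h : ∀ y ∈ S \ {v, σ v}, w v (switch v y σ v) * g σ = w v (σ y) * g σ := by
    intro y hy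
    simp only [mem_sdiff, mem_insert, mem_singleton, not_or] at hy
    rw [switch_apply_left hσ hy.1 hy.2.2]
  rw [sum_congr rfl h, ← sum_mul, sum_sdiff_pair hv (apply_mem hσ hv) (apply_ne hσ hv).symm,
    sum_comp_apply hσ (fun j => w v j), hw.row v hv, apply_apply hσ, hw.diag]
  ring

/-- The span of the centred canonical indicators is an eigenspace of the switching form. -/
lemma sum_switchSum_mul_switchSum (hw : IsBalanced S w) {n : ℕ} (hS : S.card = 2 * n)
    (g : Perm V → ℝ) :
    ∑ σ ∈ matchings S, ∑ v ∈ S, switchSum S (edgeSum S w) σ v * switchSum S g σ v =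
      (8 * (n - 2) * (n ^ 2 - 3 * n + 1) + 4 * (n - 1)) *
        ∑ σ ∈ matchings S, edgeSum S w σ * g σ := by
  have h1 : ∑ v ∈ S, ∑ σ ∈ matchings S, edgeSum S w σ * switchSum S g σ v =
      (4 * n ^ 2 - 12 * n + 4) * ∑ σ ∈ matchings S, edgeSum S w σ * g σ := by
    rw [sum_congr rfl fun v hv => sum_mul_switchSum hv _ _, sum_comm, mul_sum]
    refine sum_congr rfl fun σ hσ => ?_
    rw [← sum_mul, sum_switchSum_eq hw hS hσ, mul_assoc]
  have h2 : ∑ v ∈ S, ∑ σ ∈ matchings S, w v (σ v) * switchSum S g σ v =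
      -∑ σ ∈ matchings S, edgeSum S w σ * g σ := by
    rw [sum_congr rfl fun v hv => sum_weight_mul_switchSum hw hv g, sum_neg_distrib, sum_comm]
    simp only [edgeSum, sum_mul]
  have h3 : ∀ σ ∈ matchings S, ∀ v ∈ S,
      switchSum S (edgeSum S w) σ v * switchSum S g σ v =
        (2 * n - 4) * (edgeSum S w σ * switchSum S g σ v) -
          (4 * n - 4) * (w v (σ v) * switchSum S g σ v) := by
    intro σ hσ v hv
    rw [switchSum_edgeSum hw hS hσ hv]
    ring
  rw [sum_congr rfl fun σ hσ => sum_congr rfl (h3 σ hσ), sum_comm]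
  simp only [sum_sub_distrib, ← mul_sum]
  rw [h1, h2]
  ring

end

/-! ### Splitting a function into an edge count and an edge-free part. -/

section Decomposition

variable {S : Finset V} {w : V → V → ℝ}

lemma sum_apply_matchings {i : V} (hi : i ∈ S) (n : ℕ)
    (hS : S.card = 2 * (n + 1)) (c : V → ℝ) :
    ∑ σ ∈ matchings S, c (σ i) = (2 * n - 1)‼ * ∑ j ∈ S.erase i, c j := by
  rw [sum_eq_sum_fiber hi, mul_sum]
  refine sum_congr rfl fun j hj => ?_
  have hj' := mem_of_mem_erase hj
  have hij := (ne_of_mem_erase hj).symm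
  rw [sum_congr rfl (g := fun _ => c j) fun σ hσ => by rw [(mem_filter.1 hσ).2],
    sum_filter_apply_eq hi hj' hij (fun _ => c j), sum_const,
    card_matchings n _ (by rw [card_sdiff_pair hi hj' hij]; omega), nsmul_eq_mul]

/-- The edge `ab` itself accounts for the term with `(2n+1)‼`. Any other vertex `i` meets the rest
of its row, of sum `-w i a - w i b`; summed over `i` this is `2 w a b` again, with factor `(2n-1)‼`.
-/
lemma sum_edgeSum_of_apply_eq (hw : IsBalanced S w) {n : ℕ} (hS : S.card = 2 * (n + 2)) {a b : V}
    (ha : a ∈ S) (hb : b ∈ S) (hab : a ≠ b) :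
    ∑ σ ∈ matchings S with σ a = b, edgeSum S w σ =
      2 * ((2 * n + 1)‼ + (2 * n - 1)‼) * w a b := by
  have hc := card_sdiff_pair ha hb hab
  rw [sum_filter_apply_eq ha hb hab]
  have h1 : ∀ τ ∈ matchings (S \ {a, b}), edgeSum S w (τ * swap a b) =
      2 * w a b + ∑ i ∈ S \ {a, b}, w i (τ i) := by
    intro τ hτ
    have := sum_sdiff_pair ha hb hab fun i => w i ((τ * swap a b) i)
    rw [link_apply_left hτ, link_apply_right hτ, hw.symm b a] at this
    have h2 : ∑ i ∈ S \ {a, b}, w i ((τ * swap a b) i) = ∑ i ∈ S \ {a, b}, w i (τ i) := by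
      refine sum_congr rfl fun i hi => ?_
      simp only [mem_sdiff, mem_insert, mem_singleton, not_or] at hi
      rw [link_apply_of_ne hi.2.1 hi.2.2]
    rw [h2] at this
    unfold edgeSum
    linarith
  have h3 : ∀ i ∈ S \ {a, b}, ∑ τ ∈ matchings (S \ {a, b}), w i (τ i) =
      (2 * n - 1)‼ * (-w i a - w i b) := by
    intro i hi
    rw [sum_apply_matchings hi n (by omega) fun j => w i j]
    have h4 := add_sum_erase _ (fun j => w i j) hi
    rw [sum_sdiff_pair ha hb hab, hw.row i (mem_sdiff.1 hi).1, hw.diag] at h4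
    congr 1
    linarith
  rw [sum_congr rfl h1, sum_add_distrib, sum_const, card_matchings (n + 1) _ (by omega),
    sum_comm, sum_congr rfl h3, ← mul_sum, sum_sub_distrib, sum_neg_distrib,
    sum_sdiff_pair ha hb hab, sum_sdiff_pair ha hb hab]
  have hcol : ∀ j ∈ S, ∑ i ∈ S, w i j = 0 := fun j hj => by
    rw [← hw.row j hj]; exact sum_congr rfl fun i _ => hw.symm i j
  rw [hcol a ha, hcol b hb, hw.diag, hw.diag, hw.symm b a, nsmul_eq_mul,
    show 2 * (n + 1) - 1 = 2 * n + 1 by omega]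
  ring

/-- A function of total zero is the sum of a weighted edge count and a function orthogonal to
all canonical indicators. -/
lemma exists_edgeSum_add_isEdgeFree {n : ℕ} (hS : S.card = 2 * (n + 2)) (f : Perm V → ℝ)
    (hf : ∑ σ ∈ matchings S, f σ = 0) :
    ∃ w, IsBalanced S w ∧ IsEdgeFree S fun σ => f σ - edgeSum S w σ := by
  -- The factor in `sum_edgeSum_of_apply_eq`: dividing the canonical sums of `f` by it yields a
  -- weighting whose edge count has those same sums.
  set N : ℝ := 2 * ((2 * n + 1)‼ + (2 * n - 1)‼) with hN
  have hN0 : 0 < N := by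
    have h1 := Nat.doubleFactorial_pos (2 * n + 1)
    have h2 := Nat.doubleFactorial_pos (2 * n - 1)
    positivity
  let w : V → V → ℝ := fun i j =>
    if i ∈ S then (∑ σ ∈ matchings S with σ i = j, f σ) / N else 0
  have hw : IsBalanced S w := by
    refine ⟨fun i j => ?_, fun i => ?_, fun i hi => ?_⟩
    · have : ∀ i j, i ∈ S → j ∉ S → ∑ σ ∈ matchings S with σ i = j, f σ = 0 := by
        intro i j hi hj
        refine sum_eq_zero fun σ hσ => ?_
        obtain ⟨hσ, h⟩ := mem_filter.1 hσ
        exact absurd (h ▸ apply_mem hσ hi) hj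
      by_cases hi : i ∈ S <;> by_cases hj : j ∈ S <;> simp only [w, hi, hj, if_true, if_false]
      · congr 1
        exact sum_congr (filter_congr fun σ hσ => apply_eq_iff hσ) fun _ _ => rfl
      · rw [this i j hi hj, zero_div]
      · rw [this j i hj hi, zero_div]
    · by_cases hi : i ∈ S
      · simp only [w, hi, if_true]
        rw [sum_eq_zero, zero_div]
        intro σ hσ
        obtain ⟨hσ, h⟩ := mem_filter.1 hσ
        exact absurd h (apply_ne hσ hi)
      · simp [w, hi]
    · simp only [w, hi, if_true]
      rw [← sum_div, sum_fiberwise_of_maps_to (fun σ hσ => apply_mem hσ hi), hf, zero_div]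
  refine ⟨w, hw, fun i hi j hj => ?_⟩
  rw [sum_sub_distrib, sum_edgeSum_of_apply_eq hw hS hi (mem_of_mem_erase hj)
    (ne_of_mem_erase hj).symm, ← hN]
  simp only [w, hi, if_true]
  field_simp
  ring

lemma IsEdgeFree.sum_edgeSum_mul {g : Perm V → ℝ} (hg : IsEdgeFree S g) (w : V → V → ℝ) :
    ∑ σ ∈ matchings S, edgeSum S w σ * g σ = 0 := by
  simp only [edgeSum, sum_mul]
  rw [sum_comm]
  refine sum_eq_zero fun i hi => ?_
  rw [sum_eq_sum_fiber hi]
  refine sum_eq_zero fun j hj => ?_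
  rw [sum_congr rfl (g := fun σ => w i j * g σ) fun σ hσ => by rw [(mem_filter.1 hσ).2],
    ← mul_sum, hg i hi j hj, mul_zero]

lemma IsEdgeFree.sum_eq_zero {g : Perm V → ℝ} (hg : IsEdgeFree S g) (hS : S.Nonempty) :
    ∑ σ ∈ matchings S, g σ = 0 := by
  obtain ⟨i, hi⟩ := hS
  rw [sum_eq_sum_fiber hi]
  exact Finset.sum_eq_zero fun j hj => hg i hi j hj

lemma sum_edgeSum_eq_zero (hw : IsBalanced S w) {n : ℕ} (hS : S.card = 2 * (n + 1)) :
    ∑ σ ∈ matchings S, edgeSum S w σ = 0 := by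
  simp only [edgeSum]
  rw [sum_comm]
  refine Finset.sum_eq_zero fun i hi => ?_
  rw [sum_apply_matchings hi n hS fun j => w i j]
  have h4 := add_sum_erase _ (fun j => w i j) hi
  rw [hw.row i hi, hw.diag, zero_add] at h4
  rw [h4, mul_zero]

/-- Contract the edge at `i`. The switches join `i` to every vertex outside that edge once, and the
row sum zero gives the constant `-w i (σ i)`, on which the smaller operator is its degree. -/
lemma hamSum_edgeSum (hw : IsBalanced S w) {k : ℕ} (hS : S.card = 2 * (k + 2)) {σ : Perm V}
    (hσ : σ ∈ matchings S) : hamSum S (edgeSum S w) σ = -((2 * k)‼ : ℝ) * edgeSum S w σ := by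
  have h : hamSum S (edgeSum S w) σ = ∑ i ∈ S, hamSum S (fun τ => w i (τ i)) σ := by
    classical
    simp only [hamSum, edgeSum]
    rw [sum_comm]
  rw [h, edgeSum, mul_sum]
  refine sum_congr rfl fun i hi => ?_
  have hi' := apply_mem hσ hi
  have hne := apply_ne hσ hi
  have hσi := apply_apply hσ i
  rw [hamSum_link (by omega) hσ hi' hσi]
  have h1 : ∀ τ ∈ matchings (S \ {σ i, i}),
      ∑ y ∈ S \ {σ i, i}, w i (switch (σ i) y (τ * swap (σ i) i) i) = -w i (σ i) := by
    intro τ hτ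
    have hl := link_mem hi' hi hne hτ
    have e := link_apply_left hτ
    have h2 : ∀ y ∈ S \ {σ i, i}, w i (switch (σ i) y (τ * swap (σ i) i) i) = w i y := by
      intro y hy
      simp only [mem_sdiff, mem_insert, mem_singleton, not_or] at hy
      have := switch_apply_apply_left hl hi' (y := y) (by rw [e]; exact hy.2.2)
      rw [e] at this
      rw [this]
    rw [sum_congr rfl h2, sum_sdiff_pair hi' hi hne, hw.row i hi, hw.diag]
    ring
  rw [hamSum_congr h1, hamSum_const k _ (by rw [card_sdiff_pair hi' hi hne]; omega) _ _
    (unlink_mem hσ hσi)]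
  ring

end Decomposition

/-! ### The switching form, its links and the cases of four and six vertices. -/

/-- The quadratic form `∑ (switchSum f σ u)²`. -/
def switchForm (S : Finset V) (f : Perm V → ℝ) : ℝ :=
  ∑ σ ∈ matchings S, ∑ u ∈ S, switchSum S f σ u ^ 2

section

variable {S : Finset V} {σ : Perm V} {f g : Perm V → ℝ} {u v a b : V}

lemma switch_mul_swap {y : V} (hua : u ≠ a) (hub : u ≠ b) (hya : y ≠ a) (hyb : y ≠ b)
    (τ : Perm V) : switch u y (τ * swap a b) = switch u y τ * swap a b := by
  have h : swap a b * swap u y = swap u y * swap a b := by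
    rw [mul_swap_eq_swap_mul, swap_apply_of_ne_of_ne hua hub, swap_apply_of_ne_of_ne hya hyb]
  simp only [switch, mul_assoc, h]

/-- Switches away from `a` and `b` commute with removing the edge `ab`; exactly the two switches
with `a` and `b` are lost. -/
lemma switchSum_link (hσ : σ ∈ matchings S) (ha : a ∈ S) (hab : σ a = b)
    (hu : u ∈ S \ {a, b}) :
    switchSum (S \ {a, b}) (fun τ => f (τ * swap a b)) (σ * swap a b) u =
      switchSum S f σ u - f (switch u a σ) - f (switch u b σ) := by
  have hb : b ∈ S := hab ▸ apply_mem hσ ha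
  have hne : a ≠ b := fun h => apply_ne hσ ha (hab.trans h.symm)
  simp only [mem_sdiff, mem_insert, mem_singleton, not_or] at hu
  obtain ⟨hu, hua, hub⟩ := hu
  have hba : σ b = a := (apply_eq_iff hσ).1 hab
  have h1 : σ u ≠ a := fun h => hub (by rw [← hab, ← h, apply_apply hσ])
  have h2 : σ u ≠ b := fun h => hua (σ.injective (h.trans hab.symm))
  have hs : (S \ {a, b}) \ {u, σ u} = (S \ {u, σ u}) \ {a, b} := sdiff_right_comm ..
  rw [switchSum, link_apply_of_ne hua hub, hs, switchSum,
    ← sum_sdiff_pair (S := S \ {u, σ u}) (by simp [ha, Ne.symm hua, h1.symm])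
      (by simp [hb, Ne.symm hub, h2.symm]) hne fun y => f (switch u y σ)]
  refine sum_congr rfl fun y hy => ?_
  simp only [mem_sdiff, mem_insert, mem_singleton, not_or] at hy
  rw [← switch_mul_swap hua hub hy.2.1 hy.2.2, mul_assoc, swap_mul_self, mul_one]

lemma sum_sum_contract (hu : u ∈ S) (hv : v ∈ S) (huv : u ≠ v) (f : Perm V → ℝ) :
    ∑ τ ∈ matchings (S \ {u, v}), ∑ y ∈ S \ {u, v}, f (switch u y (τ * swap u v)) =
      ∑ σ ∈ matchings S, f σ - ∑ σ ∈ matchings S with σ u = v, f σ := by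
  rw [← sum_filter_apply_ne hu hv huv,
    ← sum_filter_add_sum_filter_not (matchings S) (fun σ => σ u = v) f]
  ring

lemma sum_contract_sq (hu : u ∈ S) (f : Perm V → ℝ) :
    ∑ v ∈ S.erase u, ∑ τ ∈ matchings (S \ {u, v}),
      (∑ y ∈ S \ {u, v}, f (switch u y (τ * swap u v))) ^ 2 =
      ∑ σ ∈ matchings S, switchSum S f σ u ^ 2 := by
  rw [sum_eq_sum_link hu]
  refine sum_congr rfl fun v hv => sum_congr rfl fun τ hτ => ?_
  rw [switchSum, link_apply_left hτ]

lemma IsEdgeFree.sum_link (hg : IsEdgeFree S g) (ha : a ∈ S) (hb : b ∈ S) (hab : a ≠ b) :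
    ∑ τ ∈ matchings (S \ {a, b}), g (τ * swap a b) = 0 := by
  rw [← sum_filter_apply_eq ha hb hab, hg a ha b (mem_erase.2 ⟨hab.symm, hb⟩)]

/-- The two switches at `u` produce the other two of the three matchings. -/
lemma switchSum_of_card_four (hS : S.card = 4) (hf : ∑ σ ∈ matchings S, f σ = 0)
    (hσ : σ ∈ matchings S) (hu : u ∈ S) : switchSum S f σ u = -f σ := by
  have hv := apply_mem hσ hu
  have hne := (apply_ne hσ hu).symm
  have h := sum_sum_contract hu hv hne f
  rw [sum_filter_apply_eq hu hv hne, hf, matchings_eq_singleton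
    (by rw [card_sdiff_pair hu hv hne, hS]) (unlink_mem hσ rfl)] at h
  simpa [mul_assoc, switchSum] using h

lemma hamSum_of_card_four (hS : S.card = 4) (hf : ∑ σ ∈ matchings S, f σ = 0)
    (hσ : σ ∈ matchings S) : hamSum S f σ = -f σ := by
  obtain ⟨u, hu⟩ : S.Nonempty := card_pos.1 (by omega)
  have hc := card_sdiff_pair hu (apply_mem hσ hu) (apply_ne hσ hu).symm
  rw [hamSum_link (by omega) hσ hu rfl, hamSum_of_card_eq_two (by omega) (unlink_mem hσ rfl),
    ← switchSum_of_card_four hS hf hσ hu]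
  simp [mul_assoc, switchSum]

lemma sum_switchSum_sub_sq (hσ : σ ∈ matchings S) (hu : u ∈ S) (f : Perm V → ℝ) (r : ℝ) :
    ∑ a ∈ S \ {u, σ u}, (r - f (switch u a σ) - f (switch u (σ a) σ)) =
      (S.card - 2) * r - 2 * switchSum S f σ u := by
  have hne := (apply_ne hσ hu).symm
  have hv := apply_mem hσ hu
  have h2 : ∑ a ∈ S \ {u, σ u}, f (switch u (σ a) σ) = switchSum S f σ u := by
    rw [switchSum, sum_sdiff_pair hu hv hne, sum_sdiff_pair hu hv hne,
      sum_comp_apply hσ fun a => f (switch u a σ), apply_apply hσ]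
    ring
  have h3 : 2 ≤ S.card := by
    rw [← card_pair hne]
    exact card_le_card (by simp [insert_subset_iff, hu, hv])
  rw [sum_sub_distrib, sum_sub_distrib, h2, sum_const, card_sdiff_pair hu hv hne, switchSum,
    nsmul_eq_mul, Nat.cast_sub h3]
  push_cast
  ring

/-- Every link has four vertices and total zero. Summing its identity over the four vertices `a` off
the edge of `u` gives `4B - 2B = -4 g σ` for the switch sum `B`. -/
lemma IsEdgeFree.switchSum_of_card_six (hg : IsEdgeFree S g) (hS : S.card = 6)
    (hσ : σ ∈ matchings S) (hu : u ∈ S) : switchSum S g σ u = -2 * g σ := by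
  have hne := (apply_ne hσ hu).symm
  have hv := apply_mem hσ hu
  have h : ∀ a ∈ S \ {u, σ u},
      switchSum S g σ u - g (switch u a σ) - g (switch u (σ a) σ) = -g σ := by
    intro a ha
    simp only [mem_sdiff, mem_insert, mem_singleton, not_or] at ha
    obtain ⟨ha, hau, hav⟩ := ha
    have hna := (apply_ne hσ ha).symm
    have hu' : u ∈ S \ {a, σ a} := by
      have : u ≠ σ a := fun h => hav (by rw [h, apply_apply hσ])
      simp [hu, Ne.symm hau, this]
    rw [← switchSum_link hσ ha rfl hu', switchSum_of_card_four
      (by rw [card_sdiff_pair ha (apply_mem hσ ha) hna, hS])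
      (hg.sum_link ha (apply_mem hσ ha) hna) (unlink_mem hσ rfl) hu', mul_assoc, swap_mul_self,
      mul_one]
  have h2 := sum_switchSum_sub_sq hσ hu g (switchSum S g σ u)
  rw [sum_congr rfl h, sum_const, card_sdiff_pair hu hv hne, hS, nsmul_eq_mul] at h2
  norm_num at h2
  linarith

lemma IsEdgeFree.hamSum_of_card_six (hg : IsEdgeFree S g) (hS : S.card = 6)
    (hσ : σ ∈ matchings S) : hamSum S g σ = 2 * g σ := by
  obtain ⟨u, hu⟩ : S.Nonempty := card_pos.1 (by omega)
  have hv := apply_mem hσ hu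
  have hne := (apply_ne hσ hu).symm
  have hc := card_sdiff_pair hu hv hne
  rw [hamSum_link (by omega) hσ hu rfl, hamSum_of_card_four (by omega) _ (unlink_mem hσ rfl)]
  · have := hg.switchSum_of_card_six hS hσ hu
    rw [switchSum] at this
    simp only [mul_assoc, swap_mul_self, mul_one]
    rw [this]
    ring
  · rw [sum_sum_contract hu hv hne, hg.sum_eq_zero ⟨u, hu⟩, sum_filter_apply_eq hu hv hne,
      hg.sum_link hu hv hne, sub_zero]

/-- The link switch sums at `u` average to a multiple of the full one, so convexity bounds the full
square by theirs. -/
lemma le_sum_switchForm_link {n : ℕ} (hS : S.card = 2 * n) (f : Perm V → ℝ) :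
    (2 * n - 6) * switchForm S f ≤ ∑ a ∈ S, ∑ b ∈ S.erase a,
      switchForm (S \ {a, b}) fun τ => f (τ * swap a b) := by
  have h1 : ∀ a ∈ S, ∑ b ∈ S.erase a, switchForm (S \ {a, b}) (fun τ => f (τ * swap a b)) =
      ∑ σ ∈ matchings S, ∑ u ∈ S \ {a, σ a},
        (switchSum S f σ u - f (switch u a σ) - f (switch u (σ a) σ)) ^ 2 := by
    intro a ha
    rw [sum_eq_sum_link ha]
    refine sum_congr rfl fun b hb => ?_
    rw [switchForm]
    refine sum_congr rfl fun τ hτ => ?_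
    have hl := link_mem ha (mem_of_mem_erase hb) (ne_of_mem_erase hb).symm hτ
    have e := link_apply_left hτ
    rw [e]
    refine sum_congr rfl fun u hu => ?_
    rw [← switchSum_link hl ha e hu, mul_assoc, swap_mul_self, mul_one]
  rw [sum_congr rfl h1, sum_comm, switchForm, mul_sum]
  refine sum_le_sum fun σ hσ => ?_
  have h2 : ∑ a ∈ S, ∑ u ∈ S \ {a, σ a},
      (switchSum S f σ u - f (switch u a σ) - f (switch u (σ a) σ)) ^ 2 =
      ∑ u ∈ S, ∑ a ∈ S \ {u, σ u},
      (switchSum S f σ u - f (switch u a σ) - f (switch u (σ a) σ)) ^ 2 := by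
    refine sum_comm' fun a u => ?_
    simp only [mem_sdiff, mem_insert, mem_singleton, not_or]
    have : u = σ a ↔ a = σ u := by rw [eq_comm, apply_eq_iff hσ, eq_comm]
    rw [this, eq_comm (a := u)]
    tauto
  rw [h2, mul_sum]
  refine sum_le_sum fun u hu => ?_
  set B := switchSum S f σ u
  have h3 := sum_switchSum_sub_sq hσ hu f B
  -- Tangent inequality `X² ≥ 2BX - B²`. The total is `2B((2n-2)B - 2B) - (2n-2)B² = (2n-6)B²`.
  have h4 : ∑ a ∈ S \ {u, σ u}, (2 * B * (B - f (switch u a σ) - f (switch u (σ a) σ)) - B ^ 2)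
      ≤ ∑ a ∈ S \ {u, σ u}, (B - f (switch u a σ) - f (switch u (σ a) σ)) ^ 2 :=
    sum_le_sum fun a _ => by nlinarith [sq_nonneg (f (switch u a σ) + f (switch u (σ a) σ))]
  refine le_trans (le_of_eq ?_) h4
  have h5 : 2 ≤ S.card := by
    rw [← card_pair (apply_ne hσ hu).symm]
    exact card_le_card (by simp [insert_subset_iff, hu, apply_mem hσ hu])
  rw [sum_sub_distrib, ← mul_sum, h3, sum_const, card_sdiff_pair hu (apply_mem hσ hu)
    (apply_ne hσ hu).symm, nsmul_eq_mul, Nat.cast_sub h5, hS]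
  push_cast
  ring

end

/-! ### Norm bounds by induction on the number of vertices. -/

variable {f g : Perm V → ℝ}

lemma sum_sq_edgeSum_add {S : Finset V} (hg : IsEdgeFree S g) (w : V → V → ℝ) :
    ∑ σ ∈ matchings S, (edgeSum S w σ + g σ) ^ 2 =
      ∑ σ ∈ matchings S, edgeSum S w σ ^ 2 + ∑ σ ∈ matchings S, g σ ^ 2 := by
  have := hg.sum_edgeSum_mul w
  have h : ∑ σ ∈ matchings S, (edgeSum S w σ + g σ) ^ 2 =
      ∑ σ ∈ matchings S, edgeSum S w σ ^ 2 + ∑ σ ∈ matchings S, g σ ^ 2 +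
        2 * ∑ σ ∈ matchings S, edgeSum S w σ * g σ := by
    rw [mul_sum, ← sum_add_distrib, ← sum_add_distrib]
    exact sum_congr rfl fun σ _ => by ring
  rw [h, this]
  ring

lemma switchForm_edgeSum_add {S : Finset V} {w : V → V → ℝ} (hw : IsBalanced S w) {n : ℕ}
    (hS : S.card = 2 * n) (hg : IsEdgeFree S g) :
    switchForm S (fun σ => edgeSum S w σ + g σ) =
      (8 * (n - 2) * (n ^ 2 - 3 * n + 1) + 4 * (n - 1)) *
        ∑ σ ∈ matchings S, edgeSum S w σ ^ 2 + switchForm S g := by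
  have h1 := sum_switchSum_mul_switchSum hw hS (edgeSum S w)
  have h2 := sum_switchSum_mul_switchSum hw hS g
  rw [hg.sum_edgeSum_mul, mul_zero] at h2
  simp only [pow_two (edgeSum S w _)]
  rw [← h1, ← add_zero (_ + switchForm S g), ← mul_zero 2, ← h2, switchForm, switchForm, mul_sum,
    ← sum_add_distrib, ← sum_add_distrib]
  refine sum_congr rfl fun σ _ => ?_
  rw [mul_sum, ← sum_add_distrib, ← sum_add_distrib]
  refine sum_congr rfl fun u _ => ?_
  have : switchSum S (fun σ => edgeSum S w σ + g σ) σ u =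
    switchSum S (edgeSum S w) σ u + switchSum S g σ u := sum_add_distrib
  rw [this]
  ring

lemma IsEdgeFree.switchForm_of_card_six {S : Finset V} (hg : IsEdgeFree S g) (hS : S.card = 6) :
    switchForm S g = 24 * ∑ σ ∈ matchings S, g σ ^ 2 := by
  rw [switchForm, mul_sum]
  refine sum_congr rfl fun σ hσ => ?_
  rw [sum_congr rfl fun u hu => by rw [hg.switchSum_of_card_six hS hσ hu], sum_const, hS,
    nsmul_eq_mul]
  push_cast
  ring

/-- The bound on the switching form for functions of total zero on the links transfers to
edge-free functions. -/
lemma IsEdgeFree.switchForm_le_of_link {k : ℕ} {κ : ℝ}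
    (ih : ∀ (S : Finset V) (f : Perm V → ℝ), S.card = 2 * (k + 3) →
      ∑ σ ∈ matchings S, f σ = 0 → switchForm S f ≤ κ * ∑ σ ∈ matchings S, f σ ^ 2)
    {S : Finset V} (hS : S.card = 2 * (k + 4)) (hg : IsEdgeFree S g) :
    (2 * k + 2) * switchForm S g ≤ (2 * k + 8) * κ * ∑ σ ∈ matchings S, g σ ^ 2 := by
  have h1 := le_sum_switchForm_link hS g
  have h2 : ∑ a ∈ S, ∑ b ∈ S.erase a, switchForm (S \ {a, b}) (fun τ => g (τ * swap a b)) ≤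
      ∑ a ∈ S, κ * ∑ σ ∈ matchings S, g σ ^ 2 := by
    refine sum_le_sum fun a ha => ?_
    rw [sum_eq_sum_link ha, mul_sum]
    refine sum_le_sum fun b hb => ?_
    have hb' := mem_of_mem_erase hb
    have hab := (ne_of_mem_erase hb).symm
    exact ih _ _ (by rw [card_sdiff_pair ha hb' hab]; omega) (hg.sum_link ha hb' hab)
  rw [sum_const, hS, nsmul_eq_mul] at h2
  push_cast at h1 h2
  linarith

/-- With `n = k + 3` the constant is `8(n-2)(n-1)² - 8`. It equals the edge-free value `24` at `n =
3`, dominates the eigenvalue on edge counts, and survives the passage through links since `n(n-2) ≤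
(n-1)²`. -/
lemma switchForm_le (k : ℕ) : ∀ (S : Finset V) (f : Perm V → ℝ), S.card = 2 * (k + 3) →
    ∑ σ ∈ matchings S, f σ = 0 →
    switchForm S f ≤ (8 * (k + 1) * (k + 2) ^ 2 - 8) * ∑ σ ∈ matchings S, f σ ^ 2 := by
  have main : ∀ k : ℕ, (∀ (S : Finset V) (g : Perm V → ℝ), S.card = 2 * (k + 3) →
      IsEdgeFree S g →
      switchForm S g ≤ (8 * (k + 1) * (k + 2) ^ 2 - 8) * ∑ σ ∈ matchings S, g σ ^ 2) →
      ∀ (S : Finset V) (f : Perm V → ℝ), S.card = 2 * (k + 3) → ∑ σ ∈ matchings S, f σ = 0 →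
      switchForm S f ≤ (8 * (k + 1) * (k + 2) ^ 2 - 8) * ∑ σ ∈ matchings S, f σ ^ 2 := by
    intro k h S f hS hf
    obtain ⟨w, hw, hg⟩ := exists_edgeSum_add_isEdgeFree (n := k + 1) (by omega) f hf
    have e : f = fun σ => edgeSum S w σ + (f σ - edgeSum S w σ) := by ext σ; ring
    rw [e, switchForm_edgeSum_add hw hS hg, sum_sq_edgeSum_add hg]
    refine (add_le_add ?_ (h S _ hS hg)).trans_eq (mul_add _ _ _).symm
    refine mul_le_mul_of_nonneg_right ?_ (sum_nonneg fun _ _ => sq_nonneg _)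
    push_cast
    have : (0 : ℝ) ≤ k := k.cast_nonneg
    nlinarith
  induction k with
  | zero =>
    refine main 0 fun S g hS hg => ?_
    rw [hg.switchForm_of_card_six hS]
    norm_num
  | succ k ih =>
    refine main (k + 1) fun S g hS hg => ?_
    have h := hg.switchForm_le_of_link ih hS
    have hk : (0 : ℝ) ≤ k := k.cast_nonneg
    have h0 : 0 ≤ ∑ σ ∈ matchings S, g σ ^ 2 := sum_nonneg fun _ _ => sq_nonneg _
    refine le_of_mul_le_mul_left (h.trans ?_) (show (0 : ℝ) < 2 * k + 2 by positivity)
    rw [← mul_assoc]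
    refine mul_le_mul_of_nonneg_right ?_ h0
    push_cast
    nlinarith [mul_nonneg hk hk, mul_nonneg hk (mul_nonneg hk hk)]

/-- With `n = k + 4` the constant is `8n(n-2)² - 8`. The final `-8` later excludes the least
eigenvalue. -/
lemma IsEdgeFree.switchForm_le_of_card {S : Finset V} {k : ℕ} (hS : S.card = 2 * (k + 4))
    (hg : IsEdgeFree S g) :
    switchForm S g ≤ (8 * (k + 4) * (k + 2) ^ 2 - 8) * ∑ σ ∈ matchings S, g σ ^ 2 := by
  have h := hg.switchForm_le_of_link (switchForm_le k) hS
  have hk : (0 : ℝ) ≤ k := k.cast_nonneg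
  refine le_of_mul_le_mul_left (h.trans ?_) (show (0 : ℝ) < 2 * k + 2 by positivity)
  rw [← mul_assoc]
  refine mul_le_mul_of_nonneg_right ?_ (sum_nonneg fun _ _ => sq_nonneg _)
  nlinarith

/-- Contracting edges bounds the norm of the Hamiltonian operator by the switching form. -/
lemma IsEdgeFree.sum_hamSum_sq_le_switchForm {k : ℕ} {ρ : ℝ}
    (ih : ∀ (S : Finset V) (f : Perm V → ℝ), S.card = 2 * (k + 2) →
      ∑ σ ∈ matchings S, f σ = 0 →
      ∑ σ ∈ matchings S, hamSum S f σ ^ 2 ≤ ρ * ∑ σ ∈ matchings S, f σ ^ 2)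
    {S : Finset V} (hS : S.card = 2 * (k + 3)) (hg : IsEdgeFree S g) :
    (2 * k + 6) * ∑ σ ∈ matchings S, hamSum S g σ ^ 2 ≤ ρ * switchForm S g := by
  have h : ∀ u ∈ S, ∑ σ ∈ matchings S, hamSum S g σ ^ 2 ≤
      ρ * ∑ σ ∈ matchings S, switchSum S g σ u ^ 2 := by
    intro u hu
    rw [← sum_contract_sq hu, sum_eq_sum_link hu, mul_sum]
    refine sum_le_sum fun v hv => ?_
    have hv' := mem_of_mem_erase hv
    have huv := (ne_of_mem_erase hv).symm
    refine le_trans (le_of_eq ?_) (ih (S \ {u, v}) _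
      (by rw [card_sdiff_pair hu hv' huv]; omega) (?_ : ∑ τ ∈ matchings (S \ {u, v}),
        ∑ y ∈ S \ {u, v}, g (switch u y (τ * swap u v)) = 0))
    · refine sum_congr rfl fun τ hτ => ?_
      rw [hamSum_link (by omega) (link_mem hu hv' huv hτ) hu (link_apply_left hτ), mul_assoc,
        swap_mul_self, mul_one]
    · rw [sum_sum_contract hu hv' huv, hg.sum_eq_zero ⟨u, hu⟩, hg u hu v hv, sub_zero]
  have h2 := sum_le_sum h
  rw [sum_const, hS, nsmul_eq_mul, ← mul_sum, sum_comm] at h2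
  push_cast at h2
  rw [switchForm]
  linarith

lemma sum_hamSum_edgeSum_add_sq {S : Finset V} {w : V → V → ℝ} (hw : IsBalanced S w) {k : ℕ}
    (hS : S.card = 2 * (k + 2)) (hg : IsEdgeFree S g) :
    ∑ σ ∈ matchings S, hamSum S (fun σ => edgeSum S w σ + g σ) σ ^ 2 =
      (2 * k)‼ ^ 2 * ∑ σ ∈ matchings S, edgeSum S w σ ^ 2 +
        ∑ σ ∈ matchings S, hamSum S g σ ^ 2 := by
  have h1 : ∑ σ ∈ matchings S, edgeSum S w σ * hamSum S g σ = 0 := by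
    rw [hamSum_symm, sum_congr rfl fun σ hσ => by rw [hamSum_edgeSum hw hS hσ, mul_assoc],
      ← mul_sum, hg.sum_edgeSum_mul, mul_zero]
  rw [mul_sum, ← sum_add_distrib, ← sub_eq_zero, ← mul_zero (-2 * ((2 * k)‼ : ℝ)), ← h1,
    mul_sum, ← sum_sub_distrib]
  refine sum_congr rfl fun σ hσ => ?_
  rw [hamSum_add, hamSum_edgeSum hw hS hσ]
  ring

lemma sum_hamSum_sq_le (k : ℕ) : ∀ (S : Finset V) (f : Perm V → ℝ), S.card = 2 * (k + 2) →
    ∑ σ ∈ matchings S, f σ = 0 →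
    ∑ σ ∈ matchings S, hamSum S f σ ^ 2 ≤ (2 * k)‼ ^ 2 * ∑ σ ∈ matchings S, f σ ^ 2 := by
  induction k with
  | zero =>
    intro S f hS hf
    rw [sum_congr rfl fun σ hσ => by rw [hamSum_of_card_four hS hf hσ]]
    simp
  | succ k ih =>
    intro S f hS hf
    obtain ⟨w, hw, hg⟩ := exists_edgeSum_add_isEdgeFree hS f hf
    have e : f = fun σ => edgeSum S w σ + (f σ - edgeSum S w σ) := by ext σ; ring
    rw [e, sum_hamSum_edgeSum_add_sq hw hS hg, sum_sq_edgeSum_add hg]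
    refine (add_le_add le_rfl ?_).trans_eq (mul_add _ _ _).symm
    have h1 := hg.sum_hamSum_sq_le_switchForm ih hS
    -- The constant is `(2k+6)(2k+2)²`, and `(2k+2)‼ = (2k+2)(2k)‼`.
    have h2 : switchForm S (fun σ => f σ - edgeSum S w σ) ≤
        8 * (k + 3) * (k + 1) ^ 2 * ∑ σ ∈ matchings S, (f σ - edgeSum S w σ) ^ 2 := by
      rcases k with - | k
      · rw [hg.switchForm_of_card_six hS]; norm_num
      · refine (hg.switchForm_le_of_card hS).trans
          (mul_le_mul_of_nonneg_right ?_ (sum_nonneg fun _ _ => sq_nonneg _))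
        push_cast
        linarith
    have h3 := mul_le_mul_of_nonneg_left h2 (sq_nonneg ((2 * k)‼ : ℝ))
    refine le_of_mul_le_mul_left ((h1.trans h3).trans (le_of_eq ?_))
      (show (0 : ℝ) < 2 * k + 6 by positivity)
    rw [show 2 * (k + 1) = 2 * k + 2 by ring, Nat.doubleFactorial_add_two]
    push_cast
    ring

/-- The least eigenvalue of the Hamiltonian operator is not attained on edge-free functions. -/
lemma IsEdgeFree.eq_zero_of_sum_mul_hamSum_le {S : Finset V} {k : ℕ}
    (hS : S.card = 2 * (k + 2)) (hg : IsEdgeFree S g)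
    (h : ∑ σ ∈ matchings S, g σ * hamSum S g σ ≤ -((2 * k)‼ * ∑ σ ∈ matchings S, g σ ^ 2)) :
    ∀ σ ∈ matchings S, g σ = 0 := by
  have h0 : 0 ≤ ∑ σ ∈ matchings S, g σ ^ 2 := sum_nonneg fun _ _ => sq_nonneg _
  have fin : ∑ σ ∈ matchings S, g σ ^ 2 = 0 → ∀ σ ∈ matchings S, g σ = 0 := fun h σ hσ =>
    pow_eq_zero_iff two_ne_zero |>.1 ((sum_eq_zero_iff_of_nonneg fun _ _ => sq_nonneg _).1 h σ hσ)
  rcases k with - | - | k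
  · intro σ hσ
    obtain ⟨u, hu⟩ : S.Nonempty := card_pos.1 (by omega)
    have hne := (apply_ne hσ hu).symm
    have h1 := hg.sum_link hu (apply_mem hσ hu) hne
    rw [matchings_eq_singleton (by rw [card_sdiff_pair hu (apply_mem hσ hu) hne, hS])
      (unlink_mem hσ rfl)] at h1
    simpa [mul_assoc] using h1
  -- On six vertices the norm bound is attained, but with eigenvalue `+2`.
  · refine fin (le_antisymm ?_ h0)
    have h1 : ∑ σ ∈ matchings S, g σ * hamSum S g σ = 2 * ∑ σ ∈ matchings S, g σ ^ 2 := by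
      rw [mul_sum]
      refine sum_congr rfl fun σ hσ => ?_
      rw [hg.hamSum_of_card_six hS hσ]
      ring
    rw [h1] at h
    norm_num at h
    linarith
  · refine fin (le_antisymm ?_ h0)
    have h1 := hg.sum_hamSum_sq_le_switchForm (sum_hamSum_sq_le (k + 1)) (by omega)
    have h2 := hg.switchForm_le_of_card (k := k) (by omega)
    have h3 : (0 : ℝ) < (2 * (k + 1))‼ := by exact_mod_cast Nat.doubleFactorial_pos _
    have e : ((2 * (k + 1 + 1))‼ : ℝ) = (2 * k + 4) * (2 * (k + 1))‼ := by
      rw [show 2 * (k + 1 + 1) = 2 * (k + 1) + 2 by ring, Nat.doubleFactorial_add_two]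
      push_cast
      ring
    rw [e] at h
    set c := Nat.cast (R := ℝ) (2 * (k + 1))‼
    -- Expanding this square turns the hypothesis on the quadratic form into the lower bound `h8` on
    -- the norm, which contradicts the upper bound by the margin `8c²` unless `g` vanishes.
    have h4 : 0 ≤ ∑ σ ∈ matchings S, (hamSum S g σ + (2 * k + 4) * c * g σ) ^ 2 :=
      sum_nonneg fun _ _ => sq_nonneg _
    have h5 : ∑ σ ∈ matchings S, (hamSum S g σ + (2 * k + 4) * c * g σ) ^ 2 =
        ∑ σ ∈ matchings S, hamSum S g σ ^ 2 +
        2 * ((2 * k + 4) * c) * ∑ σ ∈ matchings S, g σ * hamSum S g σ +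
        ((2 * k + 4) * c) ^ 2 * ∑ σ ∈ matchings S, g σ ^ 2 := by
      rw [mul_sum, mul_sum, ← sum_add_distrib, ← sum_add_distrib]
      exact sum_congr rfl fun σ _ => by ring
    have hk : (0 : ℝ) ≤ k := k.cast_nonneg
    have hd : 0 < (2 * k + 4) * c := by positivity
    have h6 := mul_le_mul_of_nonneg_left h (mul_nonneg two_pos.le hd.le)
    have h7 := mul_le_mul_of_nonneg_left h2 (sq_nonneg c)
    push_cast at h1
    set X := ∑ σ ∈ matchings S, g σ ^ 2
    set Y := ∑ σ ∈ matchings S, hamSum S g σ ^ 2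
    have h8 : ((2 * k + 4) * c) ^ 2 * X ≤ Y := by linarith
    have h9 := mul_le_mul_of_nonneg_left h8 (show (0 : ℝ) ≤ 2 * (k + 1) + 6 by positivity)
    have h10 : 8 * c ^ 2 * X ≤ 0 := by linarith
    exact nonpos_of_mul_nonpos_right h10 (by positivity)

/-! ### The ratio bound and the case of equality. -/

variable {S : Finset V} {F : Finset (Perm V)}

lemma not_connects_self (hS : 2 < S.card) {σ : Perm V} (hσ : σ ∈ matchings S) :
    ¬ Connects S σ σ := fun h => by
  obtain ⟨u, hu⟩ : S.Nonempty := card_pos.1 (by omega)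
  exact h.apply_ne hS hσ hσ hu rfl

lemma card_filter_apply_eq {k : ℕ} (hS : S.card = 2 * (k + 1)) {i j : V} (hi : i ∈ S)
    (hj : j ∈ S) (hij : i ≠ j) : ((matchings S).filter fun σ => σ i = j).card = (2 * k - 1)‼ := by
  rw [card_eq_sum_ones, sum_filter_apply_eq hi hj hij fun _ => 1, ← card_eq_sum_ones,
    card_matchings k _ (by rw [card_sdiff_pair hi hj hij]; omega)]

/-- A nonempty family of matchings of the extremal density whose indicator is, up to a constant, a
weighted edge count contains a canonical family. -/
lemma exists_canonical_subset {k : ℕ} (hS : S.card = 2 * (k + 3)) {w : V → V → ℝ}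
    (hw : IsBalanced S w)
    (h : ∀ σ ∈ matchings S, (if σ ∈ F then (1 : ℝ) else 0) = 1 / (2 * k + 5) + edgeSum S w σ)
    {σ : Perm V} (hσ : σ ∈ matchings S) (hσF : σ ∈ F) :
    ∃ i ∈ S, ∀ τ ∈ matchings S, τ i = σ i → τ ∈ F := by
  by_contra! hc
  set μ : ℝ := 1 / (2 * k + 5) with hμ
  have hk : (0 : ℝ) ≤ k := k.cast_nonneg
  have hμ' : μ * (2 * k + 5) = 1 := by rw [hμ]; field_simp
  -- A matching `τ ∉ F` through the edge of `i` has edge count `-μ`; the indicator summed over its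
  -- switches at `i` is nonnegative.
  have key : ∀ i ∈ S, (2 * k + 4) * w i (σ i) ≤ μ := by
    intro i hi
    obtain ⟨τ, hτ, hτi, hτF⟩ := hc i hi
    have h1 := switchSum_edgeSum hw hS hτ hi
    have h2 : 0 ≤ ∑ y ∈ S \ {i, τ i}, (μ + edgeSum S w (switch i y τ)) := by
      refine sum_nonneg fun y hy => ?_
      rw [← h _ (switch_mem hτ hi (mem_sdiff.1 hy).1)]
      split_ifs <;> norm_num
    have h3 := h τ hτ
    rw [if_neg hτF] at h3
    rw [sum_add_distrib, sum_const, card_sdiff_pair hi (apply_mem hτ hi) (apply_ne hτ hi).symm, hS,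
      show 2 * (k + 3) - 2 = 2 * k + 4 by omega, nsmul_eq_mul,
      show ∑ y ∈ S \ {i, τ i}, edgeSum S w (switch i y τ) = switchSum S (edgeSum S w) τ i from rfl,
      h1, show edgeSum S w τ = -μ by linarith, hτi] at h2
    push_cast at h2
    nlinarith
  have h1 := h σ hσ
  rw [if_pos hσF, edgeSum] at h1
  have h2 := sum_le_sum key
  rw [← mul_sum, sum_const, hS, nsmul_eq_mul, show ∑ i ∈ S, w i (σ i) = 1 - μ by linarith] at h2
  push_cast at h2
  -- Adding `key` over `S` gives `(2k+4)(1-μ) ≤ (2k+6)μ`, that is, `2k+4 ≤ (4k+10)μ = 2`.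
  nlinarith

/-- The Erdős–Ko–Rado theorem for families of matchings without Hamiltonian unions. -/
theorem card_le_and_eq_canonical {k : ℕ} (hS : S.card = 2 * (k + 2)) (hF : F ⊆ matchings S)
    (hind : ∀ σ ∈ F, ∀ τ ∈ F, σ ≠ τ → ¬ Connects S σ τ) :
    F.card ≤ (2 * k + 1)‼ ∧ (F.card = (2 * k + 1)‼ →
      ∃ i ∈ S, ∃ j ∈ S, i ≠ j ∧ F = (matchings S).filter fun σ => σ i = j) := by
  set c := Nat.cast (R := ℝ) (2 * k)‼ with hc
  set M := Nat.cast (R := ℝ) (2 * k + 1)‼ with hM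
  set x := Nat.cast (R := ℝ) F.card with hx
  have hk : (0 : ℝ) ≤ k := k.cast_nonneg
  have hc0 : 0 < c := by rw [hc]; exact_mod_cast Nat.doubleFactorial_pos _
  have hM0 : 0 < M := by rw [hM]; exact_mod_cast Nat.doubleFactorial_pos _
  have hx0 : 0 ≤ x := Nat.cast_nonneg _
  have hN : ((matchings S).card : ℝ) = (2 * k + 3) * M := by
    rw [card_matchings _ S hS, show 2 * (k + 2) - 1 = 2 * k + 1 + 2 by omega,
      Nat.doubleFactorial_add_two]
    push_cast
    ring
  obtain ⟨μ, hμ⟩ : ∃ μ : ℝ, μ * ((2 * k + 3) * M) = x := ⟨x / ((2 * k + 3) * M), by field_simp⟩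
  set f : Perm V → ℝ := fun σ => if σ ∈ F then 1 else 0 with hf
  have hsum : ∑ σ ∈ matchings S, f σ = x := by
    rw [hf, sum_ite_mem, inter_eq_right.2 hF, sum_const, nsmul_one]
  have hsq : ∑ σ ∈ matchings S, f σ ^ 2 = x := by
    rw [← hsum]
    exact sum_congr rfl fun σ _ => by simp [hf]
  have hham : ∑ σ ∈ matchings S, f σ * hamSum S f σ = 0 := by
    classical
    refine sum_eq_zero fun σ hσ => ?_
    by_cases hσF : σ ∈ F
    · rw [hamSum, sum_eq_zero, mul_zero]
      intro τ hτ
      obtain ⟨hτ, hcon⟩ := mem_filter.1 hτ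
      rw [hf]
      refine if_neg fun hτF => ?_
      by_cases e : σ = τ
      · exact not_connects_self (by omega) hτ (e ▸ hcon)
      · exact hind σ hσF τ hτF e hcon
    · simp [hf, hσF]
  have hf0 : ∑ σ ∈ matchings S, (f σ - μ) = 0 := by
    rw [sum_sub_distrib, hsum, sum_const, nsmul_eq_mul, hN, ← hμ]
    ring
  obtain ⟨w, hw, hg⟩ := exists_edgeSum_add_isEdgeFree hS _ hf0
  set g : Perm V → ℝ := fun σ => f σ - μ - edgeSum S w σ with hgdef
  have e : ∀ σ, f σ = μ + (edgeSum S w σ + g σ) := fun σ => by simp only [hgdef]; ring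
  have hg0 : ∑ σ ∈ matchings S, g σ = 0 := hg.sum_eq_zero (card_pos.1 (by omega))
  have he0 := sum_edgeSum_eq_zero hw (n := k + 1) (by omega)
  have heg := hg.sum_edgeSum_mul w
  set E := ∑ σ ∈ matchings S, edgeSum S w σ ^ 2 with hE
  set G := ∑ σ ∈ matchings S, g σ ^ 2 with hG
  set H := ∑ σ ∈ matchings S, g σ * hamSum S g σ with hH
  have hH1 : -(c * G) ≤ H := by
    by_contra! hlt
    have hz := hg.eq_zero_of_sum_mul_hamSum_le hS hlt.le
    have h1 : H = 0 := sum_eq_zero fun σ hσ => by rw [hz σ hσ, zero_mul]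
    have h2 : G = 0 := sum_eq_zero fun σ hσ => by rw [hz σ hσ]; simp
    rw [h1, h2] at hlt
    simp at hlt
  have hx1 : x = μ * x + E + G := by
    have : ∑ σ ∈ matchings S, f σ ^ 2 = ∑ σ ∈ matchings S, (μ ^ 2 + 2 * μ * edgeSum S w σ +
        2 * μ * g σ + 2 * (edgeSum S w σ * g σ) + edgeSum S w σ ^ 2 + g σ ^ 2) :=
      sum_congr rfl fun σ _ => by rw [e]; ring
    simp only [sum_add_distrib, ← mul_sum, he0, hg0, heg, sum_const, nsmul_eq_mul, hN] at this
    rw [hsq] at this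
    linear_combination this + μ * hμ
  have hham1 : ∀ σ ∈ matchings S, hamSum S f σ =
      (2 * k + 2) * c * μ + (-c * edgeSum S w σ + hamSum S g σ) := by
    intro σ hσ
    rw [show f = fun σ => μ + (edgeSum S w σ + g σ) from funext e, hamSum_add, hamSum_add,
      hamSum_edgeSum hw hS hσ, hamSum_const (k + 1) S (by omega) _ _ hσ,
      show 2 * (k + 1) = 2 * k + 2 by ring, Nat.doubleFactorial_add_two]
    push_cast
    ring
  have hgh : ∑ σ ∈ matchings S, hamSum S g σ = 0 := by
    have := hamSum_symm S (fun _ => 1) g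
    simp only [one_mul] at this
    rw [this, sum_congr rfl fun σ hσ => by rw [hamSum_const (k + 1) S (by omega) _ _ hσ],
      ← mul_sum, hg0, mul_zero]
  have heh : ∑ σ ∈ matchings S, edgeSum S w σ * hamSum S g σ = 0 := by
    rw [hamSum_symm, sum_congr rfl fun σ hσ => by rw [hamSum_edgeSum hw hS hσ, mul_assoc],
      ← mul_sum, heg, mul_zero]
  have hmain : (2 * k + 2) * c * μ * x - c * E + H = 0 := by
    have : ∑ σ ∈ matchings S, f σ * hamSum S f σ = ∑ σ ∈ matchings S,
        ((2 * k + 2) * c * μ * f σ - c * μ * edgeSum S w σ + μ * hamSum S g σ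
          - c * edgeSum S w σ ^ 2 + edgeSum S w σ * hamSum S g σ
          - c * (edgeSum S w σ * g σ) + g σ * hamSum S g σ) :=
      sum_congr rfl fun σ hσ => by rw [hham1 σ hσ, e]; ring
    simp only [sum_add_distrib, sum_sub_distrib, ← mul_sum, he0, hgh, heh, heg, hsum] at this
    rw [← hham, this]
    ring
  -- Eliminating `E` leaves the excess over the critical density against `H + cG ≥ 0`; at equality
  -- `H = -cG`, so `g` vanishes.
  have hkey : c * (x * ((2 * k + 3) * μ - 1)) = -(H + c * G) := by
    linear_combination hmain - c * hx1
  have hle : x ≤ M := by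
    by_contra! hlt
    have h1 : 1 < (2 * k + 3) * μ := by
      by_contra! h1
      have := mul_le_mul_of_nonneg_right h1 hM0.le
      linarith
    have h2 : 0 < x * ((2 * k + 3) * μ - 1) := mul_pos (hM0.trans hlt) (by linarith)
    have h3 := mul_pos hc0 h2
    linarith
  refine ⟨by rw [hx, hM] at hle; exact_mod_cast hle, fun heq => ?_⟩
  have hxM : x = M := by rw [hx, heq]
  have hμ1 : (2 * k + 3) * μ = 1 := by
    refine mul_right_cancel₀ hM0.ne' ?_
    linarith
  rw [hμ1, sub_self, mul_zero, mul_zero] at hkey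
  have hgz := hg.eq_zero_of_sum_mul_hamSum_le hS (show H ≤ -(c * G) by linarith)
  obtain ⟨σ, hσF⟩ : F.Nonempty := by
    rw [← card_pos, heq]; exact Nat.doubleFactorial_pos _
  have hσ := hF hσF
  suffices hsub : ∃ i ∈ S, ∀ τ ∈ matchings S, τ i = σ i → τ ∈ F by
    obtain ⟨i, hi, hsub⟩ := hsub
    refine ⟨i, hi, σ i, apply_mem hσ hi, (apply_ne hσ hi).symm, ?_⟩
    refine (eq_of_subset_of_card_le (fun τ hτ => ?_) ?_).symm
    · exact hsub τ (mem_filter.1 hτ).1 (mem_filter.1 hτ).2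
    · rw [card_filter_apply_eq (k := k + 1) (by omega) hi (apply_mem hσ hi) (apply_ne hσ hi).symm,
        heq, show 2 * (k + 1) - 1 = 2 * k + 1 by omega]
  -- On four vertices `exists_canonical_subset` does not apply, but canonical families are
  -- singletons.
  rcases k with - | k
  · obtain ⟨i, hi⟩ : S.Nonempty := card_pos.1 (by omega)
    refine ⟨i, hi, fun τ hτ h => ?_⟩
    have h1 := card_filter_apply_eq (k := 1) (by omega) hi (apply_mem hσ hi) (apply_ne hσ hi).symm
    have h2 := card_le_one.1 h1.le τ (mem_filter.2 ⟨hτ, h⟩) σ (mem_filter.2 ⟨hσ, rfl⟩)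
    rwa [h2]
  · refine exists_canonical_subset (by omega) hw (fun τ hτ => ?_) hσ hσF
    have h1 := e τ
    rw [hgz τ hτ, add_zero] at h1
    push_cast at hμ1
    refine Eq.trans (show _ = f τ from rfl) (h1.trans ?_)
    congr 1
    field_simp
    linarith

/-! ### A connected union of two matchings is a cycle. -/

section AlternatingWalk

variable {σ τ : Perm V}

/-- The walk from `v` that alternately follows the edges of `σ` and of `τ`. -/
def altWalk (σ τ : Perm V) (v : V) : ℕ → V
  | 0 => v
  | i + 1 => (if Even i then σ else τ) (altWalk σ τ v i)

lemma exists_altWalk_closed (hσ : σ ∈ matchings univ) (hτ : τ ∈ matchings univ)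
    (h : Connects univ σ τ) (v : V) :
    altWalk σ τ v (Fintype.card V) = v ∧
      Set.InjOn (altWalk σ τ v) (Set.Iio (Fintype.card V)) := by
  set w := altWalk σ τ v with hw
  set g : ℕ → Perm V := fun i => if Even i then σ else τ with hg
  have hgm : ∀ i, g i ∈ matchings univ := fun i => by
    simp only [hg]; split_ifs <;> assumption
  have hs : ∀ i, g i (w i) = w (i + 1) := fun i => rfl
  have hb : ∀ i, g i (w (i + 1)) = w i := fun i => by rw [← hs, apply_apply (hgm i)]
  have hne : ∀ i, w (i + 1) ≠ w i := fun i => by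
    rw [← hs]; exact apply_ne (hgm i) (mem_univ _)
  have hpar : ∀ i j, (Even i ↔ Even j) → g i = g j := fun i j hij => by simp only [hg, hij]
  have hex : ∃ j, ∃ i < j, w i = w j := by
    obtain ⟨a, b, hab, e⟩ := Finite.exists_ne_map_eq_of_infinite w
    rcases hab.lt_or_gt with h | h
    · exact ⟨b, a, h, e⟩
    · exact ⟨a, b, h, e.symm⟩
  classical
  obtain ⟨i, hij, e⟩ := Nat.find_spec hex
  set j := Nat.find hex with hj
  have hinj : ∀ a b, a < b → b < j → w a ≠ w b := fun a b hab hbj e =>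
    Nat.find_min hex hbj ⟨a, hab, e⟩
  obtain ⟨l, hl⟩ : ∃ l, j = l + 1 := ⟨j - 1, by omega⟩
  rw [hl] at hij e
  have hback : g l (w i) = w l := by rw [e, hb]
  -- At the first repetition `w i = w (l + 1)`, the matching of the last step cannot be the one
  -- leaving `w i`, or `w (i + 1)` would equal `w l`.
  have hfwd : ¬ (Even l ↔ Even i) := by
    intro hp
    rw [hpar l i hp, hs] at hback
    rcases lt_trichotomy (i + 1) l with h1 | h1 | h1
    · exact hinj _ _ h1 (by omega) hback
    · rw [← h1, Nat.even_add_one] at hp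
      tauto
    · have : i = l := by omega
      subst this
      exact hne _ e.symm
  -- Otherwise the last step uses the matching that entered `w i`, so `w l = w (i - 1)` is an
  -- earlier repetition.
  have hi : i = 0 := by
    by_contra hi
    obtain ⟨c, rfl⟩ : ∃ c, i = c + 1 := ⟨i - 1, by omega⟩
    rw [Nat.even_add_one] at hfwd
    rw [hpar l c (by tauto), hb] at hback
    exact hinj c l (by omega) (by omega) hback
  subst hi
  have hlodd : ¬ Even l := by simpa using hfwd
  -- The closed walk is stable under both matchings, so connectedness makes it exhaust the vertices.
  have hT : (range j).image w = univ := by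
    refine h _ (subset_univ _) ⟨w 0, mem_image_of_mem _ (by simp [hl])⟩ ?_
    intro x hx
    obtain ⟨a, ha, rfl⟩ := mem_image.1 hx
    rw [mem_range] at ha
    have m1 : g a (w a) ∈ (range j).image w := by
      rw [hs]
      by_cases h1 : a + 1 < j
      · exact mem_image_of_mem _ (mem_range.2 h1)
      · rw [show a + 1 = l + 1 by omega, ← e]
        exact mem_image_of_mem _ (mem_range.2 (by omega))
    have m2 : ∃ p, ¬ (Even p ↔ Even a) ∧ g p (w a) ∈ (range j).image w := by
      rcases a with - | a
      · exact ⟨l, by simpa using hlodd, by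
          rw [hback]; exact mem_image_of_mem _ (mem_range.2 (by omega))⟩
      · refine ⟨a, by rw [Nat.even_add_one]; tauto, ?_⟩
        rw [hb]
        exact mem_image_of_mem _ (mem_range.2 (by omega))
    obtain ⟨p, hp, m2⟩ := m2
    by_cases ha' : Even a
    · have hp' : ¬ Even p := by tauto
      simp only [hg, ha', hp', if_true, if_false] at m1 m2
      exact ⟨m1, m2⟩
    · have hp' : Even p := by tauto
      simp only [hg, ha', hp', if_true, if_false] at m1 m2
      exact ⟨m2, m1⟩
  have hinj' : Set.InjOn w (Set.Iio j) := by
    intro a ha b hb e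
    rcases lt_trichotomy a b with h1 | h1 | h1
    · exact absurd e (hinj a b h1 hb)
    · exact h1
    · exact absurd e.symm (hinj b a h1 ha)
  have hcard : Fintype.card V = j := by
    rw [← card_univ, ← hT, card_image_of_injOn (by simpa using hinj'), card_range]
  rw [hcard]
  exact ⟨by rw [hl, ← e]; rfl, hinj'⟩

/-- The union of two matchings that is connected is a cycle. -/
lemma nonempty_iso_cycleGraph (hσ : σ ∈ matchings univ) (hτ : τ ∈ matchings univ)
    (h : Connects univ σ τ) {G : SimpleGraph V} (hG : ∀ x y, G.Adj x y ↔ σ x = y ∨ τ x = y)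
    {N : ℕ} (hN : Fintype.card V = N) (hN2 : 2 < N) :
    Nonempty (G ≃g SimpleGraph.cycleGraph N) := by
  obtain ⟨m, rfl⟩ : ∃ m, N = m + 1 + 2 := ⟨N - 3, by omega⟩
  obtain ⟨v⟩ : Nonempty V := Fintype.card_pos_iff.1 (by omega)
  obtain ⟨hclosed, hinj⟩ := exists_altWalk_closed hσ hτ h v
  rw [hN] at hclosed hinj
  let w : Fin (m + 1 + 2) → V := fun a => altWalk σ τ v a
  have hwinj : Function.Injective w := fun a b e => Fin.ext (hinj a.2 b.2 e)
  have hbij : Function.Bijective w :=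
    (Fintype.bijective_iff_injective_and_card w).2 ⟨hwinj, by simp [hN]⟩
  let g : Fin (m + 1 + 2) → Perm V := fun i => if Even (i : ℕ) then σ else τ
  have hgm : ∀ i, g i ∈ matchings univ := fun i => by
    simp only [g]; split_ifs <;> assumption
  have hgor : ∀ i, g i = σ ∨ g i = τ := fun i => by
    simp only [g]; split_ifs <;> simp
  have hs : ∀ a, w (a + 1) = g a (w a) := by
    intro a
    have h1 : altWalk σ τ v (a + 1) = g a (w a) := rfl
    rw [← h1]
    by_cases ha : (a : ℕ) + 1 < m + 1 + 2
    · simp only [w]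
      rw [Fin.val_add_one_of_lt' ha]
    · have h2 : (a : ℕ) + 1 = m + 1 + 2 := by omega
      have h3 : a = Fin.last _ := Fin.ext (by simp; omega)
      rw [h2, hclosed, h3, Fin.last_add_one]
      rfl
  have hb : ∀ a, g a (w (a + 1)) = w a := fun a => by rw [hs, apply_apply (hgm a)]
  have main : ∀ a b, G.Adj (w a) (w b) ↔ b = a + 1 ∨ a = b + 1 := by
    intro a b
    rw [hG]
    constructor
    · intro hab
      obtain ⟨ρ, hρ, e⟩ : ∃ ρ, (ρ = σ ∨ ρ = τ) ∧ ρ (w a) = w b := by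
        rcases hab with h | h
        exacts [⟨σ, Or.inl rfl, h⟩, ⟨τ, Or.inr rfl, h⟩]
      by_cases h1 : ρ = g a
      · left
        rw [h1, ← hs] at e
        exact (hwinj e).symm
      right
      obtain ⟨c, rfl⟩ : ∃ c, a = c + 1 := ⟨a - 1, by simp⟩
      by_cases h2 : ρ = g c
      · rw [h2, hb] at e
        rw [hwinj e]
      · exfalso
        -- With only two matchings, one that differs from both steps at `w a` makes those steps
        -- equal; the walk would then backtrack, `w (c + 2) = w c`, impossible for length above two.
        have h3 : g c = g (c + 1) := by
          rcases hρ with rfl | rfl <;> rcases hgor c with h | h <;>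
            rcases hgor (c + 1) with h' | h' <;> simp_all
        have h4 := hs (c + 1)
        rw [← h3, hb] at h4
        have h5 : c + (1 + 1) = c + 0 := by rw [← add_assoc, hwinj h4, add_zero]
        have h6 := congrArg Fin.val (add_left_cancel h5)
        simp [Fin.val_add, Nat.mod_eq_of_lt (show 2 < m + 1 + 2 by omega)] at h6
    · rintro (rfl | rfl)
      · rw [hs]
        rcases hgor a with h | h <;> simp [h]
      · have := hb b
        rcases hgor b with h | h <;> rw [h] at this <;> simp [this]
  refine ⟨SimpleGraph.Iso.symm ⟨Equiv.ofBijective w hbij, fun {a b} => ?_⟩⟩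
  rw [Equiv.ofBijective_apply, Equiv.ofBijective_apply, main, SimpleGraph.cycleGraph_adj,
    sub_eq_iff_eq_add', sub_eq_iff_eq_add', add_comm b, add_comm a]
  tauto

end AlternatingWalk

end MatchingScheme

/-! ### Translation between perfect matchings as subgraphs and involutions. -/

namespace PerfectMatching

open MatchingScheme Equiv Finset

variable {n : ℕ}

lemma exists_unique_adj (m : PerfectMatching n) (v : Fin (2 * n)) : ∃! w, m.1.Adj v w :=
  SimpleGraph.Subgraph.isPerfectMatching_iff.1 m.2 v

/-- The vertex matched to `v`. -/
noncomputable def partner (m : PerfectMatching n) (v : Fin (2 * n)) : Fin (2 * n) :=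
  (m.exists_unique_adj v).choose

lemma adj_iff (m : PerfectMatching n) {v w : Fin (2 * n)} : m.1.Adj v w ↔ m.partner v = w :=
  ⟨fun h => ((m.exists_unique_adj v).choose_spec.2 w h).symm,
    fun h => h ▸ (m.exists_unique_adj v).choose_spec.1⟩

lemma partner_involutive (m : PerfectMatching n) : Function.Involutive m.partner :=
  fun v => m.adj_iff.1 (m.adj_iff.2 (rfl : m.partner v = _)).symm

/-- A perfect matching as a fixed-point-free involution. -/
noncomputable def toPerm (m : PerfectMatching n) : Perm (Fin (2 * n)) :=
  m.partner_involutive.toPerm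

lemma toPerm_apply_eq (m : PerfectMatching n) {v w : Fin (2 * n)} :
    m.toPerm v = w ↔ m.1.Adj v w := m.adj_iff.symm

lemma toPerm_mem (m : PerfectMatching n) : m.toPerm ∈ matchings univ :=
  mem_matchings.2 ⟨m.partner_involutive, fun v =>
    ⟨fun _ => mem_univ v, fun _ h => (m.toPerm_apply_eq.1 h).ne rfl⟩⟩

lemma toPerm_injective : Function.Injective (toPerm (n := n)) := by
  intro m m' h
  refine Subtype.ext (SimpleGraph.Subgraph.ext ?_ ?_)
  · rw [m.2.2.verts_eq_univ, m'.2.2.verts_eq_univ]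
  · ext v w
    rw [← toPerm_apply_eq, ← toPerm_apply_eq, h]

lemma exists_toPerm_eq {σ : Perm (Fin (2 * n))} (hσ : σ ∈ matchings univ) :
    ∃ m : PerfectMatching n, m.toPerm = σ := by
  let M : (⊤ : SimpleGraph (Fin (2 * n))).Subgraph :=
    { verts := Set.univ
      Adj := fun v w => σ v = w
      adj_sub := fun {v w} h => by
        rw [SimpleGraph.top_adj]
        rintro rfl
        exact apply_ne hσ (mem_univ _) h
      edge_vert := fun _ => Set.mem_univ _
      symm := ⟨fun v w h => (apply_eq_iff hσ).1 h⟩ }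
  refine ⟨⟨M, SimpleGraph.Subgraph.isPerfectMatching_iff.2 fun v =>
    ⟨σ v, rfl, fun w h => Eq.symm h⟩⟩, Equiv.ext fun v => (toPerm_apply_eq _).2 rfl⟩

lemma mem_canonicalFamily {m : PerfectMatching n} {i j : Fin (2 * n)} :
    m ∈ canonicalFamily i j ↔ m.toPerm i = j := by
  rw [toPerm_apply_eq]
  exact SimpleGraph.Subgraph.mem_edgeSet

lemma union_adj (m m' : PerfectMatching n) (x y : Fin (2 * n)) :
    (m.union m').Adj x y ↔ m.toPerm x = y ∨ m'.toPerm x = y := by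
  simp [union, toPerm_apply_eq]

lemma coe_eq_canonicalFamily_iff {F : Finset (PerfectMatching n)} {i j : Fin (2 * n)} :
    (F : Set (PerfectMatching n)) = canonicalFamily i j ↔
      F.map ⟨toPerm, toPerm_injective⟩ = (matchings univ).filter fun σ => σ i = j := by
  constructor
  · intro h
    ext σ
    rw [mem_map, mem_filter]
    constructor
    · rintro ⟨m, hm, rfl⟩
      exact ⟨m.toPerm_mem, mem_canonicalFamily.1 (h ▸ mem_coe.2 hm)⟩
    · rintro ⟨hσ, hij⟩
      obtain ⟨m, rfl⟩ := exists_toPerm_eq hσ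
      exact ⟨m, mem_coe.1 (h ▸ mem_canonicalFamily.2 hij), rfl⟩
  · intro h
    ext m
    rw [mem_coe, mem_canonicalFamily]
    have h1 : m ∈ F ↔ m.toPerm ∈ F.map ⟨toPerm, toPerm_injective⟩ :=
      (mem_map' ⟨toPerm, toPerm_injective⟩).symm
    rw [h1, h, mem_filter]
    exact ⟨fun h => h.2, fun h => ⟨m.toPerm_mem, h⟩⟩

/-- Two matchings with a common edge do not have a Hamiltonian union, unless `n = 1`. -/
lemma not_iso_cycleGraph_of_mem_canonicalFamily (hn : 2 ≤ n) {m m' : PerfectMatching n}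
    {i j : Fin (2 * n)} (hm : m ∈ canonicalFamily i j) (hm' : m' ∈ canonicalFamily i j) :
    ¬ Nonempty (m.union m' ≃g SimpleGraph.cycleGraph (2 * n)) := by
  rintro ⟨e⟩
  rw [mem_canonicalFamily] at hm hm'
  have hpre : (m.union m').Preconnected :=
    (e.preconnected_iff).2 SimpleGraph.cycleGraph_preconnected
  -- The common edge is a whole component of the union, while a cycle is connected.
  have key : ∀ z, z = i ∨ z = j := by
    intro z
    have := (SimpleGraph.reachable_iff_reflTransGen i z).1 (hpre i z)
    induction this with
    | refl => exact Or.inl rfl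
    | tail _ h ih =>
      rw [union_adj] at h
      have h1 := (apply_eq_iff m.toPerm_mem).1 hm
      have h2 := (apply_eq_iff m'.toPerm_mem).1 hm'
      rcases ih with rfl | rfl <;> rcases h with rfl | rfl <;> simp [*]
  have h1 : (univ : Finset (Fin (2 * n))) ⊆ {i, j} := fun z _ => by simpa using key z
  have h2 := (card_le_card h1).trans card_le_two
  rw [card_univ, Fintype.card_fin] at h2
  omega

lemma eq_of_card_eq_two (m m' : PerfectMatching 1) :
    m = m' := by
  have h := card_matchings 1 (univ : Finset (Fin (2 * 1))) (by simp)
  exact toPerm_injective (card_le_one.1 h.le _ m.toPerm_mem _ m'.toPerm_mem)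

end PerfectMatching

theorem mainTheorem4 (n : ℕ) (hn : 1 ≤ n) (F : Finset (PerfectMatching n)) :
    (PerfectMatching.IsNonHamiltonian F → F.card ≤ (2 * n - 3)‼) ∧
    ((PerfectMatching.IsNonHamiltonian F ∧ F.card = (2 * n - 3)‼) ↔
      PerfectMatching.IsCanonicallyIntersecting F) := by
  have hback : PerfectMatching.IsCanonicallyIntersecting F →
      PerfectMatching.IsNonHamiltonian F ∧ F.card = (2 * n - 3)‼ := by
    rintro ⟨i, j, hij, h⟩
    refine ⟨fun m hm m' hm' hne => ?_, ?_⟩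
    · rcases hn.eq_or_lt with rfl | hn
      · exact absurd (PerfectMatching.eq_of_card_eq_two m m') hne
      · exact PerfectMatching.not_iso_cycleGraph_of_mem_canonicalFamily hn
          (h ▸ Finset.mem_coe.2 hm) (h ▸ Finset.mem_coe.2 hm')
    · rw [← Finset.card_map ⟨PerfectMatching.toPerm, PerfectMatching.toPerm_injective⟩,
        PerfectMatching.coe_eq_canonicalFamily_iff.1 h,
        MatchingScheme.card_filter_apply_eq (k := n - 1) (by simp; omega) (Finset.mem_univ _)
          (Finset.mem_univ _) hij]
      congr 1
      omega
  have hforw : PerfectMatching.IsNonHamiltonian F → F.card ≤ (2 * n - 3)‼ ∧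
      (F.card = (2 * n - 3)‼ → PerfectMatching.IsCanonicallyIntersecting F) := by
    intro hF
    rcases hn.eq_or_lt with rfl | hn
    -- Here `2 * 1 - 3` truncates to `0`, and `0‼ = 1` agrees with the convention for `(-1)‼`.
    · have h1 := PerfectMatching.eq_of_card_eq_two
      refine ⟨Finset.card_le_one.2 fun m _ m' _ => h1 m m', fun hc => ?_⟩
      obtain ⟨m, hm⟩ := Finset.card_eq_one.1 hc
      refine ⟨0, m.toPerm 0, (MatchingScheme.apply_ne m.toPerm_mem (Finset.mem_univ _)).symm, ?_⟩
      ext m'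
      rw [h1 m' m, hm, PerfectMatching.mem_canonicalFamily]
      simp
    · obtain ⟨k, rfl⟩ : ∃ k, n = k + 2 := ⟨n - 2, by omega⟩
      have h := MatchingScheme.card_le_and_eq_canonical (k := k) (S := Finset.univ)
        (F := F.map ⟨PerfectMatching.toPerm, PerfectMatching.toPerm_injective⟩) (by simp)
        (fun σ hσ => by
          obtain ⟨m, -, rfl⟩ := Finset.mem_map.1 hσ
          exact m.toPerm_mem) (by
        intro σ hσ τ hτ hne hcon
        obtain ⟨m, hm, rfl⟩ := Finset.mem_map.1 hσ
        obtain ⟨m', hm', rfl⟩ := Finset.mem_map.1 hτ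
        exact hF m hm m' hm' (fun e => hne (by rw [e]))
          (MatchingScheme.nonempty_iso_cycleGraph m.toPerm_mem m'.toPerm_mem hcon
            (m.union_adj m') (by simp) (by omega)))
      rw [Finset.card_map, show 2 * k + 1 = 2 * (k + 2) - 3 by omega] at h
      refine ⟨h.1, fun hc => ?_⟩
      obtain ⟨i, -, j, -, hij, e⟩ := h.2 hc
      exact ⟨i, j, hij, PerfectMatching.coe_eq_canonicalFamily_iff.2 e⟩
  exact ⟨fun hF => (hforw hF).1, fun h => (hforw h.1).2 h.2, hback⟩
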